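/- Let $s=p/q$ with integers $0<p<q$, let $x_1,\dots,x_k\in\mathbb R$ be distinct and $V_1,\dots,V_k\in\mathbb R$. Put $I=(-1,1)$, work with complex-valued functions, let $c_s=\frac{s4^s\Gamma(1/2+s)}{\sqrt\pi\,\Gamma(1-s)}$, let $H^s_0(I)$ be the space of all $u\in L^2(I)$ whose extension by zero lies in $H^s(\mathbb R)$, and let (functions being extended by zero) $$\mathcal E[u,v]=\frac{c_s}{2}\iint_{\mathbb R\times\mathbb R}\frac{(u(x)-u(y))\overline{(v(x)-v(y))}}{|x-y|^{1+2s}}\,dx\,dy,\qquad u,v\in H^s_0(I).$$ The restricted fractional Laplacian $(-\Delta)^s_{res}$ is the operator in $L^2(I)$ defined weakly: its domain $D_s$ is the set of $u\in H^s_0(I)$ for which there is $f\in L^2(I)$ with $\mathcal E[u,v]=\langle f,v\rangle$ for all $v\in H^s_0(I)$, and $(-\Delta)^s_{res}u=f$. Let $$R=\{\beta\in\mathbb C:\ 2|\beta|^q<|x_i-x_j|\ \text{ for all } i\ne j\}.$$ For $\beta\in R$ define the operator $\overline T(\beta)$ in the Hilbert space $\prod_{j=1}^kL^2(I)$, with domain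 $\prod_{j=1}^k D_s$, by $$[\overline T(\beta)\underline u]_i(z)=(-\Delta)^s_{res}u_i(z)+\beta^{q+2p}\Big(V_iu_i(z)+c_s\sum_{j\ne i}\int_I (u_i(z)-u_j(w))\,K_{ij}(\beta;z,w)\,dw\Big),$$ $$K_{ij}(\beta;z,w)=|x_i-x_j|^{-(1+2s)}\Big(1+\beta^q\,\frac{z-w}{x_i-x_j}\Big)^{-(1+2s)}\quad\text{(principal branch)}.$$ Then: 1. $R$ is a connected open neighbourhood of $0$ and $(\overline T(\beta))_{\beta\in R}$ is an analytic family of type (A): each $\overline T(\beta)$ is densely defined and closed and has non-empty resolvent set, the domain $\prod_{j=1}^kD_s$ is independent of $\beta$, and for every $\underline u$ in it, $\beta\mapsto\overline T(\beta)\underline u$ is an analytic function from $R$ to $\prod_{j=1}^kL^2(I)$. 2. Let $t_\beta[\underline u,\underline v]=\sum_i\mathcal E[u_i,v_i]+\beta^{q+2p}\langle B(\beta)\underline u,\underline v\rangle$ for $\underline u,\underline v\in\prod_{j=1}^kH^s_0(I)$, where $B(\beta)\underline u$ is the vector with components the brackets in the formula above. The form domain $\prod_{j=1}^kH^s_0(I)$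 is independent of $\beta$; for all $\beta\in R$ and $\underline u,\underline f\in\prod_{j=1}^k L^2(I)$, one has $\underline u\in\prod_{j=1}^k D_s$ and $\overline T(\beta)\underline u=\underline f$ if and only if $\underline u\in\prod_{j=1}^kH^s_0(I)$ and $t_\beta[\underline u,\underline v]=\langle\underline f,\underline v\rangle$ for all $\underline v\in\prod_{j=1}^kH^s_0(I)$; and $\beta\mapsto t_\beta[\underline u,\underline v]$ is analytic on $R$ for all $\underline u,\underline v\in\prod_{j=1}^kH^s_0(I)$. 3. If $\varepsilon>0$ satisfies $2\varepsilon<|x_i-x_j|$ for all $i\ne j$, then $\beta=\varepsilon^{1/q}$ lies in $R$ and, for every $\underline u\in\prod_{j=1}^kD_s$, every $i$ and almost every $z\in I$, $$[\overline T(\beta)\underline u]_i(z)=(-\Delta)^s_{res}u_i(z)+\varepsilon^{1+2s}\Big(V_iu_i(z)+c_s\sum_{j\ne i}\int_I\frac{u_i(z)-u_j(w)}{|\varepsilon(z-w)+x_i-x_j|^{1+2s}}\,dw\Big).$$ -/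

import Mathlib

open MeasureTheory Set
open scoped ENNReal ComplexConjugate

/-! ### Unbounded operators and analytic families of type (A) -/

/-- `μ` lies in the resolvent set of the unbounded operator `T`: the map `T - μ` is a bijection of
the domain of `T` onto the whole space, with bounded inverse. -/
def MemResolventSet {H : Type*} [NormedAddCommGroup H] [InnerProductSpace ℂ H]
    (T : H →ₗ.[ℂ] H) (μ : ℂ) : Prop :=
  Function.Bijective (fun u : T.domain => T u - μ • (u : H)) ∧
    ∃ C : ℝ, ∀ u : T.domain, ‖(u : H)‖ ≤ C * ‖T u - μ • (u : H)‖

/-- `(T β)_{β ∈ R}` is an analytic family of type (A) with common operator domain `D`. -/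
structure IsAnalyticFamilyTypeA {H : Type*} [NormedAddCommGroup H] [InnerProductSpace ℂ H]
    (R : Set ℂ) (D : Submodule ℂ H) (T : R → (H →ₗ.[ℂ] H)) : Prop where
  isOpen : IsOpen R
  isConnected : IsConnected R
  dense : Dense (D : Set H)
  domain_eq : ∀ β, (T β).domain = D
  isClosed : ∀ β, (T β).IsClosed
  resolventSet_nonempty : ∀ β, ∃ μ : ℂ, MemResolventSet (T β) μ
  analytic : ∀ u ∈ D, ∃ f : ℂ → H, AnalyticOnNhd ℂ f R ∧
    ∀ (β : R) (hu : u ∈ (T β).domain), f β = T β ⟨u, hu⟩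

namespace FracLap

/-! ### The space `H^s_0(I)` and the restricted fractional Laplacian on `I = (-1, 1)` -/

/-- The interval `I = (-1, 1)`. -/
abbrev I : Set ℝ := Ioo (-1) 1

/-- The complex Hilbert space `L²(I)`. -/
abbrev L2I : Type := Lp ℂ 2 (volume.restrict I)

/-- The extension of `u ∈ L²(I)` by zero to the real line. -/
noncomputable def zeroExt (u : L2I) : ℝ → ℂ := I.indicator u

/-- The difference quotient `(u(x) - u(y)) / |x - y|^{(1+2s)/2}`, whose norm in `L²(ℝ × ℝ)` is the
Gagliardo seminorm of `u`. -/
noncomputable def gagliardoQuot (s : ℝ) (u : ℝ → ℂ) (p : ℝ × ℝ) : ℂ :=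
  (u p.1 - u p.2) / ((|p.1 - p.2| ^ ((1 + 2 * s) / 2) : ℝ) : ℂ)

theorem zeroExt_add (u v : L2I) : zeroExt (u + v) =ᵐ[volume] zeroExt u + zeroExt v := by
  have h := Lp.coeFn_add u v
  rw [Filter.EventuallyEq, ae_restrict_iff' measurableSet_Ioo] at h
  filter_upwards [h] with x hx
  by_cases hxI : x ∈ I
  · simpa only [zeroExt, indicator_of_mem hxI, Pi.add_apply, Pi.smul_apply, Pi.zero_apply] using hx hxI
  · simp [zeroExt, hxI]

theorem zeroExt_smul (a : ℂ) (u : L2I) : zeroExt (a • u) =ᵐ[volume] a • zeroExt u := by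
  have h := Lp.coeFn_smul a u
  rw [Filter.EventuallyEq, ae_restrict_iff' measurableSet_Ioo] at h
  filter_upwards [h] with x hx
  by_cases hxI : x ∈ I
  · simpa only [zeroExt, indicator_of_mem hxI, Pi.add_apply, Pi.smul_apply, Pi.zero_apply] using hx hxI
  · simp [zeroExt, hxI]

theorem zeroExt_zero : zeroExt 0 =ᵐ[volume] 0 := by
  have h := Lp.coeFn_zero ℂ 2 (volume.restrict I)
  rw [Filter.EventuallyEq, ae_restrict_iff' measurableSet_Ioo] at h
  filter_upwards [h] with x hx
  by_cases hxI : x ∈ I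
  · simpa only [zeroExt, indicator_of_mem hxI, Pi.add_apply, Pi.smul_apply, Pi.zero_apply] using hx hxI
  · simp [zeroExt, hxI]

theorem ae_prod_of_ae {P : ℝ → Prop} (h : ∀ᵐ x, P x) : ∀ᵐ p : ℝ × ℝ, P p.1 ∧ P p.2 := by
  rw [Measure.volume_eq_prod]
  exact (Measure.quasiMeasurePreserving_fst.ae h).and (Measure.quasiMeasurePreserving_snd.ae h)

theorem gagliardoQuot_add (s : ℝ) (u v : L2I) :
    gagliardoQuot s (zeroExt (u + v)) =ᵐ[volume]
      gagliardoQuot s (zeroExt u) + gagliardoQuot s (zeroExt v) := by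
  filter_upwards [ae_prod_of_ae (zeroExt_add u v)] with p hp
  simp only [gagliardoQuot, Pi.add_apply, hp.1, hp.2]
  ring

theorem gagliardoQuot_smul (s : ℝ) (a : ℂ) (u : L2I) :
    gagliardoQuot s (zeroExt (a • u)) =ᵐ[volume] a • gagliardoQuot s (zeroExt u) := by
  filter_upwards [ae_prod_of_ae (zeroExt_smul a u)] with p hp
  simp only [gagliardoQuot, Pi.smul_apply, hp.1, hp.2, smul_eq_mul]
  ring

theorem gagliardoQuot_zero (s : ℝ) : gagliardoQuot s (zeroExt 0) =ᵐ[volume] 0 := by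
  filter_upwards [ae_prod_of_ae zeroExt_zero] with p hp
  simp [gagliardoQuot, hp.1, hp.2]

/-- The space `H^s_0(I)`, as a subspace of `L²(I)`: the functions whose extension by zero has finite
Gagliardo seminorm, that is, belongs to `H^s(ℝ)`. -/
def Hs0 (s : ℝ) : Submodule ℂ L2I where
  carrier := {u | MemLp (gagliardoQuot s (zeroExt u)) 2 volume}
  add_mem' {u v} hu hv := (memLp_congr_ae (gagliardoQuot_add s u v)).2 (MemLp.add hu hv)
  zero_mem' := (memLp_congr_ae (gagliardoQuot_zero s)).2 MemLp.zero
  smul_mem' a u hu := (memLp_congr_ae (gagliardoQuot_smul s a u)).2 (MemLp.const_smul hu a)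

/-- The normalising constant `c_s = s 4^s Γ(1/2 + s) / (√π Γ(1 - s))` of the one-dimensional
fractional Laplacian. -/
noncomputable def fracConst (s : ℝ) : ℝ :=
  s * 4 ^ s * Real.Gamma (1 / 2 + s) / (√Real.pi * Real.Gamma (1 - s))

/-- The form `𝓔_res[u, v] = (c_s / 2) ∬ (u(x) - u(y)) conj(v(x) - v(y)) / |x - y|^{1+2s} dx dy`, the
integral being over `ℝ × ℝ` and `u`, `v` being extended by zero. Splitting `ℝ × ℝ` into `I × I` and
the rest, this is `(c_s / 2) ∬_{I × I} (⋯) + ∫_I κ u conj(v)` with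
`κ(x) = c_s ∫_{ℝ \ I} |x - y|^{-1-2s} dy`. -/
noncomputable def energy (s : ℝ) (u v : L2I) : ℂ :=
  ((fracConst s / 2 : ℝ) : ℂ) * ∫ p : ℝ × ℝ,
    (zeroExt u p.1 - zeroExt u p.2) * conj (zeroExt v p.1 - zeroExt v p.2) /
      ((|p.1 - p.2| ^ (1 + 2 * s) : ℝ) : ℂ)

theorem energy_integrand_eq (s : ℝ) (u v : ℝ → ℂ) (p : ℝ × ℝ) :
    (u p.1 - u p.2) * conj (v p.1 - v p.2) / ((|p.1 - p.2| ^ (1 + 2 * s) : ℝ) : ℂ) =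
      gagliardoQuot s u p * star (gagliardoQuot s v p) := by
  rcases eq_or_ne p.1 p.2 with h | h
  · simp [gagliardoQuot, h]
  · have hpos : 0 < |p.1 - p.2| := abs_pos.2 (sub_ne_zero.2 h)
    have hr : |p.1 - p.2| ^ (1 + 2 * s) =
        |p.1 - p.2| ^ ((1 + 2 * s) / 2) * |p.1 - p.2| ^ ((1 + 2 * s) / 2) := by
      rw [← Real.rpow_add hpos]; ring_nf
    simp only [gagliardoQuot]
    rw [hr]
    simp only [star_div₀, RCLike.star_def, Complex.conj_ofReal, Complex.ofReal_mul]
    rw [div_mul_div_comm]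

theorem energy_eq (s : ℝ) (u v : L2I) : energy s u v =
    ((fracConst s / 2 : ℝ) : ℂ) * ∫ p : ℝ × ℝ,
      gagliardoQuot s (zeroExt u) p * star (gagliardoQuot s (zeroExt v) p) := by
  simp only [energy, energy_integrand_eq]

theorem integrable_gagliardoQuot_mul {s : ℝ} {u v : L2I} (hu : u ∈ Hs0 s) (hv : v ∈ Hs0 s) :
    Integrable (fun p => gagliardoQuot s (zeroExt u) p * star (gagliardoQuot s (zeroExt v) p)) :=
  MemLp.integrable_mul (p := 2) (q := 2) hu (MemLp.star hv)

theorem energy_add_left {s : ℝ} {u u' v : L2I} (hu : u ∈ Hs0 s) (hu' : u' ∈ Hs0 s)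
    (hv : v ∈ Hs0 s) : energy s (u + u') v = energy s u v + energy s u' v := by
  simp only [energy_eq]
  rw [← mul_add, ← integral_add (integrable_gagliardoQuot_mul hu hv)
    (integrable_gagliardoQuot_mul hu' hv)]
  congr 1
  apply integral_congr_ae
  filter_upwards [gagliardoQuot_add s u u'] with p hp
  simp only [hp, Pi.add_apply, add_mul]

theorem energy_smul_left (s : ℝ) (a : ℂ) (u v : L2I) :
    energy s (a • u) v = a * energy s u v := by
  simp only [energy_eq]
  rw [mul_left_comm]
  congr 1
  rw [← integral_const_mul]
  apply integral_congr_ae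
  filter_upwards [gagliardoQuot_smul s a u] with p hp
  simp only [hp, Pi.smul_apply, smul_eq_mul, mul_assoc]

/-- The graph of `(-Δ)^s_res` in `L²(I)`, in the weak sense: the pairs `(u, f)` with
`u ∈ H^s_0(I)`, `f ∈ L²(I)` and `𝓔_res[u, v] = ⟨f, v⟩` for all `v ∈ H^s_0(I)` (the inner product of
Mathlib is linear in the second variable). -/
noncomputable def resFracLapGraph (s : ℝ) : Submodule ℂ (L2I × L2I) where
  carrier := {uf | uf.1 ∈ Hs0 s ∧ ∀ v ∈ Hs0 s, energy s uf.1 v = inner ℂ v uf.2}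
  add_mem' {a b} ha hb := ⟨add_mem ha.1 hb.1, fun v hv => by
    rw [Prod.fst_add, Prod.snd_add, energy_add_left ha.1 hb.1 hv, ha.2 v hv, hb.2 v hv,
      inner_add_right]⟩
  zero_mem' := ⟨zero_mem _, fun v _ => by
    have h := energy_smul_left s 0 0 v
    rw [zero_smul, zero_mul] at h
    simpa using h⟩
  smul_mem' c a ha := ⟨Submodule.smul_mem _ c ha.1, fun v hv => by
    rw [Prod.smul_fst, Prod.smul_snd, energy_smul_left, ha.2 v hv, inner_smul_right]⟩

/-- The restricted fractional Laplacian `(-Δ)^s_res`, as an unbounded operator in `L²(I)`. Its domain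
consists of the `u ∈ H^s_0(I)` for which `(-Δ)^s_res u`, taken weakly, lies in `L²(I)`. -/
noncomputable def resFracLap (s : ℝ) : L2I →ₗ.[ℂ] L2I := (resFracLapGraph s).toLinearPMap

/-! ### The product space and the rescaled operators -/

/-- The Hilbert space `∏_{j=1}^k L²(I)`. -/
abbrev ProdL2 (k : ℕ) : Type := PiLp 2 (fun _ : Fin k => L2I)

/-- The space `∏_{j=1}^k H^s_0(I)`. -/
def ProdHs0 (k : ℕ) (s : ℝ) : Submodule ℂ (ProdL2 k) where
  carrier := {u | ∀ i, u i ∈ Hs0 s}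
  add_mem' hu hv i := add_mem (hu i) (hv i)
  zero_mem' _ := zero_mem _
  smul_mem' a _ hu i := Submodule.smul_mem _ a (hu i)

/-- The `k`-fold product of the domain of `(-Δ)^s_res`. -/
noncomputable def prodDomain (k : ℕ) (s : ℝ) : Submodule ℂ (ProdL2 k) where
  carrier := {u | ∀ i, u i ∈ (resFracLap s).domain}
  add_mem' hu hv i := add_mem (hu i) (hv i)
  zero_mem' _ := zero_mem _
  smul_mem' a _ hu i := Submodule.smul_mem _ a (hu i)

/-- The operator `(u_1, …, u_k) ↦ ((-Δ)^s_res u_1, …, (-Δ)^s_res u_k)`. -/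
noncomputable def prodFracLap (k : ℕ) (s : ℝ) : ProdL2 k →ₗ.[ℂ] ProdL2 k where
  domain := prodDomain k s
  toFun :=
    { toFun := fun u => WithLp.toLp 2 fun i => resFracLap s ⟨u.1 i, u.2 i⟩
      map_add' := fun u v => by
        ext1 i
        exact (resFracLap s).map_add ⟨u.1 i, u.2 i⟩ ⟨v.1 i, v.2 i⟩
      map_smul' := fun a u => by
        ext1 i
        exact (resFracLap s).map_smul a ⟨u.1 i, u.2 i⟩ }

/-- The parameter region: the complex `β` such that `2 |β|^q < |x_i - x_j|` for all `i ≠ j`. A real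
`β = ε^{1/q} > 0` lies in it if and only if `|x_i - x_j| > 2 ε` for all `i ≠ j`. -/
def region {k : ℕ} (x : Fin k → ℝ) (q : ℕ) : Set ℂ :=
  {β | ∀ i j, i ≠ j → 2 * ‖β‖ ^ q < |x i - x j|}

/-- The kernel `|d|^{-(1+2s)} (1 + ε (z - w) / d)^{-(1+2s)}` for complex `ε`, where the second power
is the principal one, the sum of the binomial series. For real `ε` with `2 |ε| < |d|` and `z, w ∈ I`
it equals `|ε (z - w) + d|^{-(1+2s)}`. -/
noncomputable def kernel (s d : ℝ) (ε : ℂ) (z w : ℝ) : ℂ :=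
  ((|d| ^ (-(1 + 2 * s)) : ℝ) : ℂ) *
    (1 + ε * ((z - w : ℝ) : ℂ) / (d : ℂ)) ^ ((-(1 + 2 * s) : ℝ) : ℂ)

/-- The `i`-th component
`V_i u_i(z) + c_s ∑_{j ≠ i} ∫_I (u_i(z) - u_j(w)) |ε (z - w) + x_i - x_j|^{-(1+2s)} dw`
of the perturbation, with the kernel extended to complex `ε`. -/
noncomputable def perturbFun {k : ℕ} (s : ℝ) (x V : Fin k → ℝ) (ε : ℂ) (u : ProdL2 k) (i : Fin k)
    (z : ℝ) : ℂ :=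
  (V i : ℂ) * u i z + (fracConst s : ℂ) * ∑ j ∈ Finset.univ.erase i,
    ∫ w in I, (u i z - u j w) * kernel s (x i - x j) ε z w

theorem measurable_kernel (s d : ℝ) (ε : ℂ) :
    Measurable (fun p : ℝ × ℝ => kernel s d ε p.1 p.2) := by
  unfold kernel
  fun_prop

theorem norm_kernel_le {s d : ℝ} {ε : ℂ} (h : 2 * ‖ε‖ < |d|) :
    ∃ M : ℝ, 0 ≤ M ∧ ∀ z ∈ I, ∀ w ∈ I, ‖kernel s d ε z w‖ ≤ M := by
  have hd : 0 < |d| := lt_of_le_of_lt (by positivity) h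
  have hb0 : 0 < 1 - 2 * ‖ε‖ / |d| := by
    rw [sub_pos, div_lt_one hd]; exact h
  have hcont : ContinuousOn (fun t : ℝ => t ^ (-(1 + 2 * s)))
      (Icc (1 - 2 * ‖ε‖ / |d|) (1 + 2 * ‖ε‖ / |d|)) := fun t ht =>
    (Real.continuousAt_rpow_const _ _ (Or.inl (hb0.trans_le ht.1).ne')).continuousWithinAt
  obtain ⟨M, hM⟩ := isCompact_Icc.exists_bound_of_continuousOn hcont
  have hM0 : 0 ≤ M := (norm_nonneg _).trans (hM 1 ⟨by
    have : 0 ≤ 2 * ‖ε‖ / |d| := by positivity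
    linarith, by
    have : 0 ≤ 2 * ‖ε‖ / |d| := by positivity
    linarith⟩)
  refine ⟨|d| ^ (-(1 + 2 * s)) * M, by positivity, fun z hz w hw => ?_⟩
  have hzw : |z - w| ≤ 2 := by
    rw [abs_le]; constructor <;> linarith [hz.1, hz.2, hw.1, hw.2]
  have hζ : ‖ε * ((z - w : ℝ) : ℂ) / (d : ℂ)‖ ≤ 2 * ‖ε‖ / |d| := by
    rw [norm_div, norm_mul, Complex.norm_real, Complex.norm_real, Real.norm_eq_abs,
      Real.norm_eq_abs]
    refine div_le_div_of_nonneg_right ?_ hd.le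
    nlinarith [norm_nonneg ε]
  have h1 := norm_sub_le_norm_add (1 : ℂ) (ε * ((z - w : ℝ) : ℂ) / (d : ℂ))
  have h2 := norm_add_le (1 : ℂ) (ε * ((z - w : ℝ) : ℂ) / (d : ℂ))
  rw [norm_one] at h1 h2
  have h3 := hM ‖1 + ε * ((z - w : ℝ) : ℂ) / (d : ℂ)‖ ⟨by linarith, by linarith⟩
  unfold kernel
  rw [norm_mul, Complex.norm_real, Complex.norm_cpow_real, Real.norm_eq_abs,
    abs_of_nonneg (by positivity)]
  exact mul_le_mul_of_nonneg_left ((le_abs_self _).trans h3) (by positivity)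

theorem ae_mem_I : ∀ᵐ z ∂(volume.restrict I), z ∈ I := ae_restrict_mem measurableSet_Ioo

theorem integrable_L2I (u : L2I) : Integrable u (volume.restrict I) :=
  (Lp.memLp u).integrable (by norm_num)

theorem integrable_kernel_mul {s d : ℝ} {ε : ℂ} (h : 2 * ‖ε‖ < |d|) (a : ℂ) (v : L2I) {z : ℝ}
    (hz : z ∈ I) :
    Integrable (fun w => (a - v w) * kernel s d ε z w) (volume.restrict I) := by
  obtain ⟨M, -, hM⟩ := norm_kernel_le (s := s) h
  refine Integrable.mul_bdd (c := M) ((integrable_const a).sub (integrable_L2I v)) ?_ ?_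
  · exact ((measurable_kernel s d ε).comp measurable_prodMk_left).aestronglyMeasurable
  · filter_upwards [ae_mem_I] with w hw using hM z hz w hw

theorem memLp_kernel_integral {s d : ℝ} {ε : ℂ} (h : 2 * ‖ε‖ < |d|) (u v : L2I) :
    MemLp (fun z => ∫ w in I, (u z - v w) * kernel s d ε z w) 2 (volume.restrict I) := by
  obtain ⟨M, hM0, hM⟩ := norm_kernel_le (s := s) h
  have hg : MemLp (fun z => M * (2 * ‖u z‖ + ∫ w in I, ‖v w‖)) 2 (volume.restrict I) :=
    ((((Lp.memLp u).norm.const_mul 2).add (memLp_const (∫ w in I, ‖v w‖))).const_mul M)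
  refine hg.mono' ?_ ?_
  · refine AEStronglyMeasurable.integral_prod_right'
      (f := fun p : ℝ × ℝ => (u p.1 - v p.2) * kernel s d ε p.1 p.2) ?_
    exact (((Lp.aestronglyMeasurable u).comp_fst).sub ((Lp.aestronglyMeasurable v).comp_snd)).mul
      (measurable_kernel s d ε).aestronglyMeasurable
  · filter_upwards [ae_mem_I] with z hz
    have hb : Integrable (fun w => M * (‖u z‖ + ‖v w‖)) (volume.restrict I) :=
      ((integrable_const ‖u z‖).add (integrable_L2I v).norm).const_mul M
    refine (norm_integral_le_of_norm_le hb ?_).trans (le_of_eq ?_)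
    · filter_upwards [ae_mem_I] with w hw
      rw [norm_mul, mul_comm]
      exact mul_le_mul (hM z hz w hw) (norm_sub_le _ _) (norm_nonneg _) hM0
    · rw [integral_const_mul, integral_add (integrable_const _) (integrable_L2I v).norm,
        integral_const]
      norm_num

theorem memLp_perturbFun {k : ℕ} (s : ℝ) (x V : Fin k → ℝ) {ε : ℂ}
    (hε : ∀ i j, i ≠ j → 2 * ‖ε‖ < |x i - x j|) (u : ProdL2 k) (i : Fin k) :
    MemLp (perturbFun s x V ε u i) 2 (volume.restrict I) := by
  refine ((Lp.memLp (u i)).const_mul (V i : ℂ)).add (MemLp.const_mul ?_ (fracConst s : ℂ))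
  exact memLp_finsetSum _ fun j hj =>
    memLp_kernel_integral (hε i j (Finset.ne_of_mem_erase hj).symm) (u i) (u j)

/-- The perturbation as a linear map on `∏ L²(I)`. -/
noncomputable def perturb {k : ℕ} (s : ℝ) (x V : Fin k → ℝ) (ε : ℂ)
    (hε : ∀ i j, i ≠ j → 2 * ‖ε‖ < |x i - x j|) : ProdL2 k →ₗ[ℂ] ProdL2 k where
  toFun u := WithLp.toLp 2 fun i => (memLp_perturbFun s x V hε u i).toLp
  map_add' u v := by
    ext1 i
    change (memLp_perturbFun s x V hε (u + v) i).toLp =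
      (memLp_perturbFun s x V hε u i).toLp + (memLp_perturbFun s x V hε v i).toLp
    rw [← MemLp.toLp_add, MemLp.toLp_eq_toLp_iff]
    have hall : ∀ᵐ w ∂(volume.restrict I), ∀ j, (u + v) j w = u j w + v j w :=
      ae_all_iff.2 fun j => Lp.coeFn_add (u j) (v j)
    filter_upwards [hall, ae_mem_I] with z hz hzI
    simp only [perturbFun, Pi.add_apply]
    have hsum : ∀ j ∈ Finset.univ.erase i,
        ∫ w in I, ((u + v) i z - (u + v) j w) * kernel s (x i - x j) ε z w =
        (∫ w in I, (u i z - u j w) * kernel s (x i - x j) ε z w) +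
          ∫ w in I, (v i z - v j w) * kernel s (x i - x j) ε z w := fun j hj => by
      have hij := hε i j (Finset.ne_of_mem_erase hj).symm
      rw [← integral_add (integrable_kernel_mul hij _ (u j) hzI)
        (integrable_kernel_mul hij _ (v j) hzI)]
      apply integral_congr_ae
      filter_upwards [hall] with w hw
      rw [hw j, hz i]; ring
    rw [Finset.sum_congr rfl hsum, Finset.sum_add_distrib, hz i]
    ring
  map_smul' a u := by
    ext1 i
    change (memLp_perturbFun s x V hε (a • u) i).toLp = a • (memLp_perturbFun s x V hε u i).toLp
    rw [← MemLp.toLp_const_smul, MemLp.toLp_eq_toLp_iff]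
    have hall : ∀ᵐ w ∂(volume.restrict I), ∀ j, (a • u) j w = a * u j w :=
      ae_all_iff.2 fun j => Lp.coeFn_smul a (u j)
    filter_upwards [hall, ae_mem_I] with z hz hzI
    simp only [perturbFun, Pi.smul_apply, smul_eq_mul]
    have hsum : ∀ j ∈ Finset.univ.erase i,
        ∫ w in I, ((a • u) i z - (a • u) j w) * kernel s (x i - x j) ε z w =
        a * ∫ w in I, (u i z - u j w) * kernel s (x i - x j) ε z w := fun j _ => by
      rw [← integral_const_mul]
      apply integral_congr_ae
      filter_upwards [hall] with w hw
      rw [hw j, hz i]; ring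
    rw [Finset.sum_congr rfl hsum, ← Finset.mul_sum, hz i]
    ring

theorem norm_pow_of_mem_region {k : ℕ} {x : Fin k → ℝ} {q : ℕ} (β : region x q) :
    ∀ i j, i ≠ j → 2 * ‖(β : ℂ) ^ q‖ < |x i - x j| := by
  intro i j hij
  rw [norm_pow]
  exact β.2 i j hij

/-- The rescaled operator `T̄(β)`, with `s = p / q` and `ε = β^q`, so that `ε^{1+2s} = β^{q+2p}`:
`[T̄(β) u]_i = (-Δ)^s_res u_i
  + β^{q+2p} (V_i u_i + c_s ∑_{j ≠ i} ∫_I (u_i - u_j(w)) |β^q (z - w) + x_i - x_j|^{-(1+2s)} dw)`. -/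
noncomputable def rescaledOp {k : ℕ} (x V : Fin k → ℝ) (p q : ℕ) (β : region x q) :
    ProdL2 k →ₗ.[ℂ] ProdL2 k :=
  ((β : ℂ) ^ (q + 2 * p) • perturb ((p : ℝ) / q) x V ((β : ℂ) ^ q) (norm_pow_of_mem_region β)) +ᵥ
    prodFracLap k ((p : ℝ) / q)

/-- The weak form `⟨T̄(β) u, v⟩` of the rescaled operator, defined for all
`u, v ∈ ∏ H^s_0(I)` through `𝓔_res`. -/
noncomputable def rescaledForm {k : ℕ} (x V : Fin k → ℝ) (p q : ℕ) (β : region x q)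
    (u v : ProdL2 k) : ℂ :=
  ∑ i, energy ((p : ℝ) / q) (u i) (v i) + (β : ℂ) ^ (q + 2 * p) *
    inner ℂ v (perturb ((p : ℝ) / q) x V ((β : ℂ) ^ q) (norm_pow_of_mem_region β) u)

end FracLap

/-! ### Accretive operators and their bounded perturbations. -/

section Abstract

variable {H : Type*} [NormedAddCommGroup H] [InnerProductSpace ℂ H]

/-! With `ε = β^q`, the family is `A + β^(q+2p) B(ε)`, where `A` is the product of restricted
fractional Laplacians, which does not depend on `β`, and `B(ε)` is bounded. So the operator domain
and the form domain are those of `A`, and two things need proof: that `A` is a good operator, and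
that `B(ε)` is analytic in `ε`.

The operator `A` is accretive because the energy is nonnegative, and `A + M` is onto for every `M >
0` (`resFracLap_add_surjective`, an orthogonal projection onto a closed graph). Hence `‖(A + M)⁻¹‖ ≤
1/M`, and for `M` larger than the norm of the perturbation a Neumann series inverts the perturbed
operator plus `M` (`exists_memResolventSet_vadd`). A nonempty resolvent set forces closedness;
accretivity together with surjectivity of `A + 1` forces density of the domain.

For analyticity, the kernel is viewed as a point of the Banach algebra of bounded continuous
functions on `ℝ × ℝ`. There it is a binomial series in `ε (z - w)/d`, which converges because `|z -
w| ≤ 2` and `2|ε| < |d|` (`analyticOnNhd_kernelBCF`). The integral operator is bounded bilinear in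
the kernel and the pair of functions (`kernelOp`), so it inherits the analyticity. The weak form is
treated by moving the bounded term to the right-hand side, and at real `ε > 0` the principal power
is the real one. -/

theorem MemResolventSet.isClosed {T : H →ₗ.[ℂ] H} {μ : ℂ} (h : MemResolventSet T μ) :
    T.IsClosed := by
  obtain ⟨⟨-, hsurj⟩, C, hC⟩ := h
  refine IsSeqClosed.isClosed fun z w hz hw => ?_
  -- The solution `v` is the only candidate for the limit: the resolvent bound applied to
  -- differences with `v` makes the first components converge to `v`, whence `w.1 = v`.
  obtain ⟨v, hv⟩ := hsurj (w.2 - μ • w.1)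
  replace hv : T v - μ • (v : H) = w.2 - μ • w.1 := hv
  have h1 := (continuous_fst.tendsto w).comp hw
  have h2 := (continuous_snd.tendsto w).comp hw
  have hlim : Filter.Tendsto (fun n => C * ‖(z n).2 - μ • (z n).1 - (w.2 - μ • w.1)‖)
      Filter.atTop (nhds 0) := by
    simpa using ((h2.sub (h1.const_smul μ)).sub_const (w.2 - μ • w.1)).norm.const_mul C
  have hv' : Filter.Tendsto (fun n => (z n).1) Filter.atTop (nhds (v : H)) := by
    rw [tendsto_iff_norm_sub_tendsto_zero]
    refine squeeze_zero (fun _ => norm_nonneg _) (fun n => ?_) hlim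
    obtain ⟨y, hy1, hy2⟩ := (T.mem_graph_iff).1 (hz n)
    have := hC (y - v)
    rw [T.map_sub, Submodule.coe_sub, smul_sub, sub_sub_sub_comm] at this
    rw [← hy1, ← hy2, ← hv]
    exact this
  have heq : w.1 = v := tendsto_nhds_unique h1 hv'
  refine (T.mem_graph_iff).2 ⟨v, heq.symm, ?_⟩
  rw [← heq] at hv
  simpa using hv

/-- An operator is accretive if `0 ≤ re ⟪u, A u⟫` on its domain; then `‖u‖ ≤ M⁻¹ ‖(A + M) u‖`. -/
theorem norm_le_of_accretive {A : H →ₗ.[ℂ] H}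
    (hacc : ∀ u : A.domain, 0 ≤ (inner ℂ (u : H) (A u)).re) (M : ℝ) (u : A.domain) :
    M * ‖(u : H)‖ ≤ ‖A u + (M : ℂ) • (u : H)‖ := by
  have h1 : (inner ℂ (u : H) (A u + (M : ℂ) • (u : H))).re =
      (inner ℂ (u : H) (A u)).re + M * ‖(u : H)‖ ^ 2 := by
    rw [inner_add_right, inner_smul_right, inner_self_eq_norm_sq_to_K, Complex.add_re,
      Complex.re_ofReal_mul]
    norm_cast
  have h2 : (inner ℂ (u : H) (A u + (M : ℂ) • (u : H))).re ≤
      ‖(u : H)‖ * ‖A u + (M : ℂ) • (u : H)‖ :=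
    (Complex.re_le_norm _).trans (norm_inner_le_norm _ _)
  rcases (norm_nonneg (u : H)).eq_or_lt with h0 | h0
  · rw [← h0, mul_zero]; exact norm_nonneg _
  · refine le_of_mul_le_mul_left ?_ h0
    have := hacc u
    nlinarith

/-- If `g` is orthogonal to the domain, write `g = (A + 1) u` and pair with `u`: the real part reads
`re ⟪u, A u⟫ + ‖u‖² = 0` with both terms nonnegative, so `u = 0` and `g = 0`. -/
theorem dense_domain_of_accretive [CompleteSpace H] {A : H →ₗ.[ℂ] H}
    (hacc : ∀ u : A.domain, 0 ≤ (inner ℂ (u : H) (A u)).re)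
    (hsurj : ∀ f : H, ∃ u : A.domain, A u + ((1 : ℝ) : ℂ) • (u : H) = f) :
    Dense (A.domain : Set H) := by
  rw [Submodule.dense_iff_topologicalClosure_eq_top, Submodule.topologicalClosure_eq_top_iff,
    Submodule.eq_bot_iff]
  intro g hg
  obtain ⟨u, rfl⟩ := hsurj g
  have h1 := (Submodule.mem_orthogonal _ _).1 hg u u.2
  rw [inner_add_right, inner_smul_right, inner_self_eq_norm_sq_to_K] at h1
  have h2 := congrArg Complex.re h1
  rw [Complex.add_re, Complex.re_ofReal_mul, Complex.zero_re] at h2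
  have h3 : ‖(u : H)‖ ^ 2 ≤ 0 := by
    have := hacc u
    have h4 : (((‖(u : H)‖ : ℝ) : ℂ) ^ 2).re = ‖(u : H)‖ ^ 2 := by norm_cast
    have h5 : 1 * (((‖(u : H)‖ : ℝ) : ℂ) ^ 2).re = - (inner ℂ (u : H) (A u)).re := by
      exact eq_neg_of_add_eq_zero_right h2
    linarith
  have h4 : (u : H) = 0 := by
    rw [← norm_eq_zero]
    exact pow_eq_zero_iff two_ne_zero |>.1 (le_antisymm h3 (sq_nonneg _))
  have h5 : u = 0 := Subtype.ext h4
  rw [h5, A.map_zero]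
  simp

/-- If `A` is accretive and `A + M` is surjective for all `M > 0`, then the sum of `A` and a bounded
operator has non-empty resolvent set. -/
theorem exists_memResolventSet_vadd [CompleteSpace H] {A : H →ₗ.[ℂ] H}
    (hsurj : ∀ M : ℝ, 0 < M → ∀ f : H, ∃ u : A.domain, A u + (M : ℂ) • (u : H) = f)
    (hacc : ∀ u : A.domain, 0 ≤ (inner ℂ (u : H) (A u)).re) (B : H →L[ℂ] H) : ∃ μ : ℂ, MemResolventSet ((B : H →ₗ[ℂ] H) +ᵥ A) μ := by
  -- The margin `M - ‖B‖ = 1` gives the lower bound with constant `1`, and `‖B‖ / M < 1` makes the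
  -- Neumann series converge.
  set M : ℝ := ‖B‖ + 1 with hM
  have hM0 : 0 < M := by positivity
  have hlow : ∀ u : A.domain, ‖(u : H)‖ ≤ 1 * ‖B u + A u - (-(M : ℂ)) • (u : H)‖ := fun u => by
    have h1 := norm_le_of_accretive hacc M u
    have h2 := B.le_opNorm u
    have h3 : ‖A u + (M : ℂ) • (u : H)‖ ≤ ‖B u + A u - (-(M : ℂ)) • (u : H)‖ + ‖B u‖ := by
      refine le_trans (le_of_eq ?_) (norm_sub_le _ _)
      congr 1
      rw [neg_smul]; abel
    rw [hM] at h1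
    linarith
  have hinj : ∀ u : A.domain, A u + (M : ℂ) • (u : H) = 0 → u = 0 := fun u hu => by
    have h1 := norm_le_of_accretive hacc M u
    rw [hu, norm_zero] at h1
    have : ‖(u : H)‖ ≤ 0 := by
      by_contra hc
      push Not at hc
      nlinarith
    exact Subtype.ext (norm_le_zero_iff.1 this)
  let L : A.domain →ₗ[ℂ] H := A.toFun + (M : ℂ) • A.domain.subtype
  have hL : ∀ u, L u = A u + (M : ℂ) • (u : H) := fun u => rfl
  let e : A.domain ≃ₗ[ℂ] H := LinearEquiv.ofBijective L
    ⟨(injective_iff_map_eq_zero L).2 hinj, hsurj M hM0⟩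
  have he : ∀ f, A (e.symm f) + (M : ℂ) • (e.symm f : H) = f := fun f => e.apply_symm_apply f
  -- `S = (A + M)⁻¹`; accretivity gives its norm bound `M⁻¹`.
  let S : H →L[ℂ] H := LinearMap.mkContinuous (A.domain.subtype ∘ₗ (e.symm : H →ₗ[ℂ] A.domain)) M⁻¹
    fun f => by
      have := norm_le_of_accretive hacc M (e.symm f)
      rw [he f] at this
      rw [inv_mul_eq_div, le_div_iff₀ hM0, mul_comm]
      exact this
  have hS : ∀ f, S f = (e.symm f : H) := fun f => rfl
  have hBS : ‖-(B * S)‖ < 1 := by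
    rw [norm_neg]
    calc ‖B * S‖ ≤ ‖B‖ * ‖S‖ := norm_mul_le _ _
      _ ≤ ‖B‖ * M⁻¹ := by
        gcongr
        exact LinearMap.mkContinuous_norm_le _ (by positivity) _
      _ < 1 := by rw [← div_eq_mul_inv, div_lt_one hM0]; linarith
  refine ⟨-(M : ℂ), ⟨fun u v huv => ?_, fun f => ?_⟩, 1, hlow⟩
  · have := hlow (u - v)
    rw [A.map_sub, Submodule.coe_sub, map_sub, smul_sub] at this
    have h0 : B (u : H) + A u - -(M : ℂ) • (u : H) = B (v : H) + A v - -(M : ℂ) • (v : H) := huv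
    have h1 : B (u : H) - B (v : H) + (A u - A v) - (-(M : ℂ) • (u : H) - -(M : ℂ) • (v : H)) = 0 := by
      rw [← sub_eq_zero] at h0
      rw [← h0]; abel
    rw [h1, norm_zero, mul_zero] at this
    exact Subtype.ext (sub_eq_zero.1 (norm_le_zero_iff.1 this))
  -- Since `B + A + M = (1 + B S)(A + M)` on the domain, the solution is `S g` with `g = (1 + B S)⁻¹
  -- f`.
  · obtain ⟨U, hU⟩ := isUnit_one_sub_of_norm_lt_one hBS
    have hg : ((U : H →L[ℂ] H) * ((U⁻¹ : (H →L[ℂ] H)ˣ) : H →L[ℂ] H)) f = f := by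
      rw [Units.mul_inv]; rfl
    set g := ((U⁻¹ : (H →L[ℂ] H)ˣ) : H →L[ℂ] H) f with hgdef
    rw [hU] at hg
    refine ⟨e.symm g, ?_⟩
    change B (e.symm g : H) + A (e.symm g) - -(M : ℂ) • (e.symm g : H) = f
    have h2 : g + B (S g) = f := by simpa [sub_neg_eq_add] using hg
    rw [← h2, hS, neg_smul, sub_neg_eq_add, add_assoc, he g, add_comm]

end Abstract

/-! ### The restricted fractional Laplacian: density of the form domain, accretivity, surjectivity.
-/

namespace FracLap

theorem fracConst_pos {s : ℝ} (h0 : 0 < s) (h1 : s < 1) : 0 < fracConst s := by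
  have := Real.Gamma_pos_of_pos (show 0 < 1 / 2 + s by linarith)
  have := Real.Gamma_pos_of_pos (show 0 < 1 - s by linarith)
  unfold fracConst
  positivity

theorem zeroExt_toLp {φ : ℝ → ℂ} (h : MemLp φ 2 (volume.restrict I)) (hsupp : ∀ x ∉ I, φ x = 0) :
    zeroExt h.toLp =ᵐ[volume] φ := by
  have h' := h.coeFn_toLp
  rw [Filter.EventuallyEq, ae_restrict_iff' measurableSet_Ioo] at h'
  filter_upwards [h'] with x hx
  by_cases hxI : x ∈ I
  · rw [zeroExt, indicator_of_mem hxI, hx hxI]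
  · rw [zeroExt, indicator_of_notMem hxI, hsupp x hxI]

theorem gagliardoQuot_congr (s : ℝ) {u v : ℝ → ℂ} (h : u =ᵐ[volume] v) :
    gagliardoQuot s u =ᵐ[volume] gagliardoQuot s v := by
  filter_upwards [ae_prod_of_ae h] with p hp
  simp only [gagliardoQuot, hp.1, hp.2]

theorem norm_gagliardoQuot_sq (s : ℝ) (u : ℝ → ℂ) (p : ℝ × ℝ) :
    ‖gagliardoQuot s u p‖ ^ 2 = ‖u p.1 - u p.2‖ ^ 2 / |p.1 - p.2| ^ (1 + 2 * s) := by
  rw [gagliardoQuot, norm_div, div_pow, Complex.norm_real, Real.norm_eq_abs,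
    abs_of_nonneg (by positivity), ← Real.rpow_mul_natCast (abs_nonneg _)]
  congr 2
  push_cast
  ring

/-- A majorant, depending on `|x - y|` only, of the squared difference quotient of a bounded
Lipschitz function. -/
theorem integrable_min_rpow {s : ℝ} (h0 : 0 < s) (h1 : s < 1) (a b : ℝ) :
    Integrable (fun t : ℝ => if |t| ≤ 1 then a * |t| ^ (1 - 2 * s) else b * |t| ^ (-(1 + 2 * s))) := by
  -- Polar coordinates in dimension one leave an integral over the half-line; `1 - 2s > -1` settles
  -- it at zero and `-(1 + 2s) < -1` at infinity.
  have key := integrable_fun_norm_addHaar (volume : Measure ℝ)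
    (f := fun r : ℝ => if r ≤ 1 then a * r ^ (1 - 2 * s) else b * r ^ (-(1 + 2 * s)))
  simp only [Real.norm_eq_abs, Module.finrank_self, Nat.sub_self, pow_zero, one_smul] at key
  rw [key, ← Ioc_union_Ioi_eq_Ioi zero_le_one]
  refine IntegrableOn.union ?_ ?_
  · have : IntegrableOn (fun r : ℝ => a * r ^ (1 - 2 * s)) (Ioc 0 1) := by
      rw [← intervalIntegrable_iff_integrableOn_Ioc_of_le zero_le_one]
      exact (intervalIntegral.intervalIntegrable_rpow' (by linarith)).const_mul a
    refine this.congr_fun (fun r hr => ?_) measurableSet_Ioc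
    simp [hr.2]
  · have : IntegrableOn (fun r : ℝ => b * r ^ (-(1 + 2 * s))) (Ioi 1) :=
      (integrableOn_Ioi_rpow_of_lt (by linarith) zero_lt_one).const_mul b
    refine this.congr_fun (fun r hr => ?_) measurableSet_Ioi
    simp [not_le.2 (show 1 < r from hr)]

/-- The Lipschitz bound controls the quotient near the diagonal and the sup bound controls it far
away. As `φ` vanishes off `I`, the quotient vanishes unless one of the two points lies in `I`, so
`(1_I(x) + 1_I(y)) g(x - y)` is a majorant, integrable as a sum of convolution integrands. -/
theorem memLp_gagliardoQuot_of_lipschitz {s : ℝ} (h0 : 0 < s) (h1 : s < 1) {φ : ℝ → ℂ}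
    {C : NNReal} (hC : LipschitzWith C φ) {M : ℝ} (hM : ∀ x, ‖φ x‖ ≤ M)
    (hsupp : ∀ x ∉ I, φ x = 0) : MemLp (gagliardoQuot s φ) 2 volume := by
  have hφ : Continuous φ := hC.continuous
  have hmeas : Measurable (gagliardoQuot s φ) := by
    have := hφ.measurable
    unfold gagliardoQuot
    fun_prop
  rw [memLp_two_iff_integrable_sq_norm hmeas.aestronglyMeasurable]
  set g : ℝ → ℝ := fun t => if |t| ≤ 1 then (C : ℝ) ^ 2 * |t| ^ (1 - 2 * s)
    else (2 * M) ^ 2 * |t| ^ (-(1 + 2 * s)) with hg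
  have hgi : Integrable g := integrable_min_rpow h0 h1 _ _
  have hg0 : ∀ t, 0 ≤ g t := fun t => by
    simp only [hg]; split_ifs <;> positivity
  have hgneg : ∀ t, g (-t) = g t := fun t => by simp only [hg, abs_neg]
  have hI : Integrable (I.indicator (1 : ℝ → ℝ)) :=
    (integrable_indicator_iff measurableSet_Ioo).2 (integrableOn_const (by simp))
  have h2 : Integrable (fun p : ℝ × ℝ => I.indicator (1 : ℝ → ℝ) p.2 * g (p.1 - p.2)) :=
    Integrable.convolution_integrand (ContinuousLinearMap.mul ℝ ℝ) hI hgi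
  have h1 : Integrable (fun p : ℝ × ℝ => I.indicator (1 : ℝ → ℝ) p.1 * g (p.1 - p.2)) := by
    refine (Integrable.swap (μ := (volume : Measure ℝ)) (ν := (volume : Measure ℝ)) h2).congr ?_
    refine Filter.Eventually.of_forall fun p => ?_
    simp only [Function.comp, Prod.fst_swap, Prod.snd_swap]
    rw [← neg_sub, hgneg]
  have hbd : ∀ p : ℝ × ℝ, ‖gagliardoQuot s φ p‖ ^ 2 ≤ g (p.1 - p.2) := fun p => by
    rw [norm_gagliardoQuot_sq]
    have hL : ‖φ p.1 - φ p.2‖ ≤ C * |p.1 - p.2| := by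
      simpa [dist_eq_norm] using hC.dist_le_mul p.1 p.2
    have hB : ‖φ p.1 - φ p.2‖ ≤ 2 * M := by
      linarith [norm_sub_le (φ p.1) (φ p.2), hM p.1, hM p.2]
    rcases eq_or_ne p.1 p.2 with h | h
    · rw [h, sub_self, norm_zero]
      simpa using hg0 0
    have hpos : 0 < |p.1 - p.2| := abs_pos.2 (sub_ne_zero.2 h)
    simp only [hg]
    split_ifs with hle
    · have : |p.1 - p.2| ^ (1 - 2 * s) = |p.1 - p.2| ^ 2 / |p.1 - p.2| ^ (1 + 2 * s) := by
        rw [← Real.rpow_natCast, ← Real.rpow_sub hpos]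
        congr 1
        push_cast
        ring
      rw [this, ← mul_div_assoc, ← mul_pow]
      gcongr
    · rw [Real.rpow_neg hpos.le, ← div_eq_mul_inv]
      gcongr
  refine (h1.add h2).mono' (hmeas.norm.pow_const 2).aestronglyMeasurable
    (Filter.Eventually.of_forall fun p => ?_)
  rw [Real.norm_eq_abs, abs_of_nonneg (sq_nonneg _), Pi.add_apply]
  have hgp := hg0 (p.1 - p.2)
  by_cases hp1 : p.1 ∈ I
  · by_cases hp2 : p.2 ∈ I <;> simp only [hp1, hp2, indicator_of_mem, indicator_of_notMem,
      not_false_eq_true, Pi.one_apply] <;> linarith [hbd p]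
  · by_cases hp2 : p.2 ∈ I
    · simp only [hp1, hp2, indicator_of_mem, indicator_of_notMem,
      not_false_eq_true, Pi.one_apply]
      linarith [hbd p]
    · simp [gagliardoQuot, hp1, hp2, hsupp]

theorem toLp_mem_Hs0 {s : ℝ} (h0 : 0 < s) (h1 : s < 1) {φ : ℝ → ℂ}
    {C : NNReal} (hC : LipschitzWith C φ) {M : ℝ} (hM : ∀ x, ‖φ x‖ ≤ M)
    (hsupp : ∀ x ∉ I, φ x = 0) (h : MemLp φ 2 (volume.restrict I)) : h.toLp ∈ Hs0 s :=
  (memLp_congr_ae (gagliardoQuot_congr s (zeroExt_toLp h hsupp))).2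
    (memLp_gagliardoQuot_of_lipschitz h0 h1 hC hM hsupp)

/-- `H^s_0(I)` is dense in `L²(I)`: its orthogonal complement is trivial. -/
theorem eq_zero_of_forall_inner_Hs0 {s : ℝ} (h0 : 0 < s) (h1 : s < 1) {f : L2I}
    (hf : ∀ v ∈ Hs0 s, inner ℂ v f = 0) : f = 0 := by
  have hfi : IntegrableOn f I := integrable_L2I f
  -- Test functions supported in `I` are bounded and Lipschitz, hence lie in `H^s_0(I)`; the
  -- fundamental lemma of the calculus of variations then applies.
  have key : ∀ᵐ x, x ∈ I → f x = 0 := by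
    refine isOpen_Ioo.ae_eq_zero_of_integral_contDiff_smul_eq_zero hfi.locallyIntegrableOn
      fun g hg hgc hgI => ?_
    have hsupp : ∀ x ∉ I, (g x : ℂ) = 0 := fun x hx => by
      rw [image_eq_zero_of_notMem_tsupport fun h => hx (hgI h), Complex.ofReal_zero]
    obtain ⟨C, hC⟩ := (hg.of_le (by simp : (1 : WithTop ℕ∞) ≤ _)).lipschitzWith_of_hasCompactSupport
      hgc one_ne_zero
    have hC' : LipschitzWith C (fun x => (g x : ℂ)) := by
      refine LipschitzWith.of_dist_le_mul fun x y => ?_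
      rw [Complex.dist_eq, ← Complex.ofReal_sub, Complex.norm_real, ← dist_eq_norm]
      exact hC.dist_le_mul x y
    obtain ⟨M, hM⟩ := hgc.exists_bound_of_continuous hg.continuous
    have hM' : ∀ x, ‖(g x : ℂ)‖ ≤ M := fun x => by
      rw [Complex.norm_real]; exact hM x
    have hLp : MemLp (fun x => (g x : ℂ)) 2 (volume.restrict I) :=
      MemLp.of_bound hC'.continuous.aestronglyMeasurable M (Filter.Eventually.of_forall hM')
    have h2 := hf _ (toLp_mem_Hs0 h0 h1 hC' hM' hsupp hLp)
    rw [L2.inner_def] at h2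
    have h3 : ∫ x in I, g x • f x = 0 := by
      rw [← h2]
      refine integral_congr_ae ?_
      filter_upwards [hLp.coeFn_toLp] with x hx
      rw [hx, RCLike.inner_apply, Complex.conj_ofReal, mul_comm, Complex.real_smul]
    rw [← h3]
    refine (setIntegral_eq_integral_of_forall_compl_eq_zero fun x hx => ?_).symm
    have := hsupp x hx
    rw [Complex.real_smul, this, zero_mul]
  rw [Lp.eq_zero_iff_ae_eq_zero, Filter.EventuallyEq, ae_restrict_iff' measurableSet_Ioo]
  exact key

/-- `Submodule.toLinearPMap` returns the given graph only when that graph is single-valued; this is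
where density of `H^s_0(I)` enters. -/
theorem mem_resFracLap_graph {s : ℝ} (h0 : 0 < s) (h1 : s < 1) {u f : L2I} :
    (u, f) ∈ (resFracLap s).graph ↔
      u ∈ Hs0 s ∧ ∀ v ∈ Hs0 s, energy s u v = inner ℂ v f := by
  rw [resFracLap, Submodule.toLinearPMap_graph_eq]
  · rfl
  · rintro ⟨u, f⟩ ⟨-, h⟩ (rfl : u = 0)
    refine eq_zero_of_forall_inner_Hs0 h0 h1 fun v hv => ?_
    have h2 := energy_smul_left s 0 0 v
    rw [zero_smul, zero_mul] at h2
    exact (h v hv).symm.trans h2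

theorem energy_self_re_nonneg {s : ℝ} (h0 : 0 < s) (h1 : s < 1) (u : L2I) :
    0 ≤ (energy s u u).re := by
  have h : (∫ p : ℝ × ℝ, gagliardoQuot s (zeroExt u) p * star (gagliardoQuot s (zeroExt u) p)) =
      ((∫ p : ℝ × ℝ, ‖gagliardoQuot s (zeroExt u) p‖ ^ 2 : ℝ) : ℂ) := by
    rw [← integral_complex_ofReal]
    refine integral_congr_ae (Filter.Eventually.of_forall fun p => ?_)
    change _ * conj _ = _
    rw [Complex.mul_conj, Complex.normSq_eq_norm_sq]
  rw [energy_eq, h, ← Complex.ofReal_mul, Complex.ofReal_re]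
  have := fracConst_pos h0 h1
  have h3 : 0 ≤ ∫ p : ℝ × ℝ, ‖gagliardoQuot s (zeroExt u) p‖ ^ 2 :=
    integral_nonneg fun _ => sq_nonneg _
  positivity

theorem resFracLap_accretive {s : ℝ} (h0 : 0 < s) (h1 : s < 1) (u : (resFracLap s).domain) :
    0 ≤ (inner ℂ (u : L2I) (resFracLap s u)).re := by
  obtain ⟨hu, h⟩ := (mem_resFracLap_graph h0 h1).1 ((resFracLap s).mem_graph u)
  rw [← h u hu]
  exact energy_self_re_nonneg h0 h1 _

/-- The graph `{(u, a G u)}` of a multiple of the difference quotient map `G` of `H^s_0(I)`. -/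
def gagliardoGraph (s : ℝ) (a : ℂ) :
    Submodule ℂ (WithLp 2 (L2I × Lp ℂ 2 (volume : Measure (ℝ × ℝ)))) where
  carrier := {z | z.snd =ᵐ[volume] a • gagliardoQuot s (zeroExt z.fst)}
  add_mem' {z w} hz hw := by
    filter_upwards [hz, hw, gagliardoQuot_add s z.fst w.fst, Lp.coeFn_add z.snd w.snd]
      with p h1 h2 h3 h4
    change (z.snd + w.snd : Lp ℂ 2 (volume : Measure (ℝ × ℝ))) p =
      a • gagliardoQuot s (zeroExt (z.fst + w.fst)) p
    rw [h4, h3, Pi.add_apply, h1, h2, Pi.add_apply, smul_add]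
    rfl
  zero_mem' := by
    filter_upwards [gagliardoQuot_zero s, Lp.coeFn_zero ℂ 2 (volume : Measure (ℝ × ℝ))]
      with p h1 h2
    change (0 : Lp ℂ 2 (volume : Measure (ℝ × ℝ))) p = a • gagliardoQuot s (zeroExt 0) p
    rw [h1, h2]
    exact (smul_zero a).symm
  smul_mem' c z hz := by
    filter_upwards [hz, gagliardoQuot_smul s c z.fst, Lp.coeFn_smul c z.snd] with p h1 h2 h3
    change (c • z.snd : Lp ℂ 2 (volume : Measure (ℝ × ℝ))) p =
      a • gagliardoQuot s (zeroExt (c • z.fst)) p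
    rw [h3, h2, Pi.smul_apply, h1, Pi.smul_apply, Pi.smul_apply, smul_comm]

/-- This plays the role of completeness of `H^s_0(I)` in its form norm. Along a subsequence both
components converge almost everywhere, and the difference quotient is computed pointwise from `u`,
so the relation passes to the limit. -/
theorem isClosed_gagliardoGraph (s : ℝ) (a : ℂ) :
    IsClosed (gagliardoGraph s a : Set (WithLp 2 (L2I × Lp ℂ 2 (volume : Measure (ℝ × ℝ))))) := by
  refine IsSeqClosed.isClosed fun z w hz hw => ?_
  have hfst : Filter.Tendsto (fun n => (z n).fst) Filter.atTop (nhds w.fst) :=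
    ((WithLp.prod_continuous_ofLp 2 _ _).fst.tendsto w).comp hw
  have hsnd : Filter.Tendsto (fun n => (z n).snd) Filter.atTop (nhds w.snd) :=
    ((WithLp.prod_continuous_ofLp 2 _ _).snd.tendsto w).comp hw
  obtain ⟨ns, hns, h1⟩ := (tendstoInMeasure_of_tendsto_Lp hfst).exists_seq_tendsto_ae
  obtain ⟨ms, hms, h2⟩ := (tendstoInMeasure_of_tendsto_Lp
    (hsnd.comp hns.tendsto_atTop)).exists_seq_tendsto_ae
  have h3 : ∀ᵐ x, Filter.Tendsto (fun n => zeroExt (z (ns (ms n))).fst x) Filter.atTop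
      (nhds (zeroExt w.fst x)) := by
    rw [ae_restrict_iff' measurableSet_Ioo] at h1
    filter_upwards [h1] with x hx
    by_cases hxI : x ∈ I
    · simp only [zeroExt, indicator_of_mem hxI]
      exact (hx hxI).comp hms.tendsto_atTop
    · simp only [zeroExt, indicator_of_notMem hxI]
      exact tendsto_const_nhds
  have h4 : ∀ᵐ p, ∀ n, (z n).snd p = a • gagliardoQuot s (zeroExt (z n).fst) p := ae_all_iff.2 hz
  change w.snd =ᵐ[volume] a • gagliardoQuot s (zeroExt w.fst)
  filter_upwards [h2, ae_prod_of_ae h3, h4] with p hp2 hp3 hp4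
  refine tendsto_nhds_unique hp2 ?_
  simp only [Function.comp, hp4]
  exact ((hp3.1.sub hp3.2).div_const _).const_smul a

/-- The equation `𝓔[u, v] + M ⟨u, v⟩ = ⟨f, v⟩` is solved by projecting `(M⁻¹ f, 0)` orthogonally
onto the closed subspace of pairs `(u, a G u)`, with `G` the difference quotient map. Orthogonality
of the residual to each `(v, a G v)`, multiplied by `M`, is the weak equation. -/
theorem resFracLap_add_surjective {s : ℝ} (h0 : 0 < s) (h1 : s < 1) {M : ℝ} (hM : 0 < M)
    (f : L2I) : ∃ u : (resFracLap s).domain, resFracLap s u + (M : ℂ) • (u : L2I) = f := by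
  have hc := fracConst_pos h0 h1
  -- Chosen so that `M a² = c_s / 2`, the factor in front of the energy integral.
  set a : ℝ := √(fracConst s / 2 / M) with ha
  have ha0 : a ≠ 0 := (Real.sqrt_pos.2 (by positivity)).ne'
  have haa : M * (a * a) = fracConst s / 2 := by
    rw [ha, Real.mul_self_sqrt (by positivity)]
    field_simp
  set K := gagliardoGraph s (a : ℂ) with hK
  have : CompleteSpace K := (isClosed_gagliardoGraph s (a : ℂ)).completeSpace_coe
  set y : WithLp 2 (L2I × Lp ℂ 2 (volume : Measure (ℝ × ℝ))) :=
    WithLp.toLp 2 ((M : ℂ)⁻¹ • f, 0) with hy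
  have hzK : K.starProjection y ∈ K := K.starProjection_apply_mem y
  have hort := (K.mem_orthogonal _).1 (K.sub_starProjection_mem_orthogonal y)
  set z := K.starProjection y with hz
  have hzq : z.snd =ᵐ[volume] (a : ℂ) • gagliardoQuot s (zeroExt z.fst) := hzK
  have hmem : z.fst ∈ Hs0 s := by
    have h2 : MemLp (((a : ℂ)⁻¹) • (z.snd : ℝ × ℝ → ℂ)) 2 volume := (Lp.memLp z.snd).const_smul _
    refine (memLp_congr_ae ?_).1 h2
    filter_upwards [hzq] with p hp
    rw [Pi.smul_apply, hp, Pi.smul_apply, smul_smul, inv_mul_cancel₀ (by exact_mod_cast ha0),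
      one_smul]
  have hgraph : (z.fst, f - (M : ℂ) • z.fst) ∈ (resFracLap s).graph := by
    refine (mem_resFracLap_graph h0 h1).2 ⟨hmem, fun v hv => ?_⟩
    have hv' : MemLp ((a : ℂ) • gagliardoQuot s (zeroExt v)) 2 volume := MemLp.const_smul hv _
    have h2 := hort (WithLp.toLp 2 (v, hv'.toLp)) hv'.coeFn_toLp
    rw [WithLp.prod_inner_apply] at h2
    have h3 : inner ℂ v ((M : ℂ)⁻¹ • f - z.fst) + inner ℂ hv'.toLp (0 - z.snd) = (0 : ℂ) := h2
    rw [zero_sub, inner_neg_right, ← sub_eq_add_neg, sub_eq_zero, L2.inner_def hv'.toLp] at h3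
    have h4 : (∫ p, inner ℂ ((hv'.toLp : ℝ × ℝ → ℂ) p) (z.snd p)) = ((a * a : ℝ) : ℂ) *
        ∫ p : ℝ × ℝ, gagliardoQuot s (zeroExt z.fst) p * star (gagliardoQuot s (zeroExt v) p) := by
      rw [← integral_const_mul]
      refine integral_congr_ae ?_
      filter_upwards [hzq, hv'.coeFn_toLp] with p hp1 hp2
      rw [hp1, hp2, RCLike.inner_apply, Pi.smul_apply, Pi.smul_apply, smul_eq_mul, smul_eq_mul,
        map_mul, Complex.conj_ofReal, Complex.ofReal_mul]
      change _ = _ * (_ * conj _)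
      ring
    rw [energy_eq, ← haa, Complex.ofReal_mul, mul_assoc, ← h4, ← h3, ← inner_smul_right, smul_sub,
      smul_smul, mul_inv_cancel₀ (by exact_mod_cast hM.ne'), one_smul]
  obtain ⟨u, hu1, hu2⟩ := (LinearPMap.mem_graph_iff _).1 hgraph
  refine ⟨u, ?_⟩
  rw [hu1, hu2]
  exact sub_add_cancel _ _

end FracLap

/-! ### The binomial series in the Banach algebra of bounded continuous functions. -/

open scoped BoundedContinuousFunction

/-- When the unit has norm one, the norms of the terms are those of the scalar coefficients, so the
radius is the same as over `ℂ`. -/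
theorem one_le_binomialSeries_radius (A : Type*) [NormedRing A] [NormedAlgebra ℂ A] [NormOneClass A]
    (a : ℂ) : 1 ≤ (binomialSeries A a).radius := by
  refine (binomialSeries_radius_ge_one (𝔸 := ℂ) (a := a)).trans (le_of_eq ?_)
  simp only [FormalMultilinearSeries.radius, binomialSeries,
    FormalMultilinearSeries.ofScalars_norm]

/-- A branch of `x ↦ (1 + f x) ^ a`, as a bounded continuous function, depends analytically on the
bounded continuous function `f` with `‖f‖ < 1`. -/
theorem BoundedContinuousFunction.analyticOnNhd_binomialSeries_sum (X : Type*) [TopologicalSpace X]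
    [Nonempty X] (a : ℂ) :
    AnalyticOnNhd ℂ (binomialSeries (X →ᵇ ℂ) a).sum {f | ‖f‖ < 1} := by
  have hr := one_le_binomialSeries_radius (X →ᵇ ℂ) a
  refine ((binomialSeries (X →ᵇ ℂ) a).hasFPowerSeriesOnBall
    (zero_lt_one.trans_le hr)).analyticOnNhd.mono fun f hf => ?_
  rw [Metric.mem_eball, edist_zero_right]
  refine lt_of_lt_of_le ?_ hr
  rw [← ofReal_norm, ENNReal.ofReal_lt_one]
  exact hf

/-- Evaluation at `x` is continuous and multiplicative, so it carries the series at `f` term by term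
to the scalar series at `f x`, whose sum is the principal power. -/
theorem BoundedContinuousFunction.binomialSeries_sum_apply {X : Type*} [TopologicalSpace X]
    [Nonempty X] (a : ℂ) {f : X →ᵇ ℂ} (hf : ‖f‖ < 1) (x : X) :
    (binomialSeries (X →ᵇ ℂ) a).sum f x = (1 + f x) ^ a := by
  have hr := one_le_binomialSeries_radius (X →ᵇ ℂ) a
  have hball : f ∈ Metric.eball (0 : X →ᵇ ℂ) (binomialSeries (X →ᵇ ℂ) a).radius := by
    rw [Metric.mem_eball, edist_zero_right]
    refine lt_of_lt_of_le ?_ hr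
    rw [← ofReal_norm, ENNReal.ofReal_lt_one]
    exact hf
  have h1 := ((binomialSeries (X →ᵇ ℂ) a).hasSum hball).mapL
    (BoundedContinuousFunction.evalCLM ℂ x)
  have hx : f x ∈ Metric.eball (0 : ℂ) 1 := by
    rw [Metric.mem_eball, edist_zero_right, ← ofReal_norm, ENNReal.ofReal_lt_one]
    exact (f.norm_coe_le_norm x).trans_lt hf
  have h2 := (Complex.one_add_cpow_hasFPowerSeriesOnBall_zero (a := a)).hasSum hx
  rw [zero_add] at h2
  have h3 : (fun n => BoundedContinuousFunction.evalCLM ℂ x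
      (binomialSeries (X →ᵇ ℂ) a n fun _ => f)) = fun n => binomialSeries ℂ a n fun _ => f x := by
    funext n
    rw [binomialSeries_apply, binomialSeries_apply]
    simp [BoundedContinuousFunction.evalCLM]
  rw [h3] at h1
  exact h1.unique h2

/-! ### The perturbation as an analytic function of `ε`. -/

namespace FracLap

/-- The projection of `ℝ` onto `[-1, 1]`. -/
noncomputable def clamp (z : ℝ) : ℝ := max (-1) (min 1 z)

theorem clamp_of_mem {z : ℝ} (hz : z ∈ I) : clamp z = z := by
  rw [clamp, min_eq_right hz.2.le, max_eq_right hz.1.le]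

theorem abs_clamp_sub_le (z w : ℝ) : |clamp z - clamp w| ≤ 2 := by
  have h : ∀ t, -1 ≤ clamp t ∧ clamp t ≤ 1 := fun t =>
    ⟨le_max_left _ _, max_le (by norm_num) (min_le_left _ _)⟩
  rw [abs_le]
  constructor <;> linarith [(h z).1, (h z).2, (h w).1, (h w).2]

/-- The function `(z, w) ↦ (z - w) / d` on `I × I`, extended to a bounded continuous function. -/
noncomputable def relDiff (d : ℝ) : (ℝ × ℝ) →ᵇ ℂ :=
  BoundedContinuousFunction.ofNormedAddCommGroup
    (fun p => ((clamp p.1 - clamp p.2 : ℝ) : ℂ) / (d : ℂ)) (by unfold clamp; fun_prop) (2 / |d|)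
    fun p => by
      rw [norm_div, Complex.norm_real, Complex.norm_real, Real.norm_eq_abs, Real.norm_eq_abs]
      gcongr
      exact abs_clamp_sub_le _ _

theorem norm_smul_relDiff_lt {d : ℝ} {ε : ℂ} (h : 2 * ‖ε‖ < |d|) : ‖ε • relDiff d‖ < 1 := by
  have hd : 0 < |d| := lt_of_le_of_lt (by positivity) h
  have h2 : ‖relDiff d‖ ≤ 2 / |d| :=
    BoundedContinuousFunction.norm_ofNormedAddCommGroup_le _ (by positivity) _
  calc ‖ε • relDiff d‖ ≤ ‖ε‖ * (2 / |d|) := by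
        rw [norm_smul]; gcongr
    _ < 1 := by rw [← mul_div_assoc, div_lt_one hd]; linarith

/-- The kernel as a bounded continuous function. -/
noncomputable def kernelBCF (s d : ℝ) (ε : ℂ) : (ℝ × ℝ) →ᵇ ℂ :=
  ((|d| ^ (-(1 + 2 * s)) : ℝ) : ℂ) •
    (binomialSeries ((ℝ × ℝ) →ᵇ ℂ) ((-(1 + 2 * s) : ℝ) : ℂ)).sum (ε • relDiff d)

theorem kernelBCF_apply {s d : ℝ} {ε : ℂ} (h : 2 * ‖ε‖ < |d|) {z w : ℝ} (hz : z ∈ I) (hw : w ∈ I) :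
    kernelBCF s d ε (z, w) = kernel s d ε z w := by
  rw [kernelBCF, BoundedContinuousFunction.smul_apply,
    BoundedContinuousFunction.binomialSeries_sum_apply _ (norm_smul_relDiff_lt h), kernel,
    smul_eq_mul, BoundedContinuousFunction.smul_apply]
  have : relDiff d (z, w) = ((z - w : ℝ) : ℂ) / (d : ℂ) := by
    change ((clamp z - clamp w : ℝ) : ℂ) / (d : ℂ) = _
    rw [clamp_of_mem hz, clamp_of_mem hw]
  rw [this, smul_eq_mul, mul_div_assoc]

/-- Analyticity holds in the sup norm, that is, uniformly in `(z, w)`; no differentiation under the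
integral sign is needed afterwards. -/
theorem analyticOnNhd_kernelBCF (s d : ℝ) :
    AnalyticOnNhd ℂ (kernelBCF s d) {ε | 2 * ‖ε‖ < |d|} := by
  intro ε hε
  have h1 : AnalyticAt ℂ (fun ε : ℂ => ε • relDiff d) ε := analyticAt_id.smul analyticAt_const
  have h3 : AnalyticAt ℂ (fun ε : ℂ => (binomialSeries ((ℝ × ℝ) →ᵇ ℂ)
      ((-(1 + 2 * s) : ℝ) : ℂ)).sum (ε • relDiff d)) ε := by
    refine AnalyticAt.fun_comp (g := (binomialSeries ((ℝ × ℝ) →ᵇ ℂ)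
      ((-(1 + 2 * s) : ℝ) : ℂ)).sum) ?_ h1
    exact BoundedContinuousFunction.analyticOnNhd_binomialSeries_sum (ℝ × ℝ) _ (ε • relDiff d)
      (norm_smul_relDiff_lt hε)
  exact h3.fun_const_smul

/-- The function `z ↦ ∫_I (u(z) - v(w)) κ(z, w) dw`. -/
noncomputable def kernelIntegral (κ : (ℝ × ℝ) →ᵇ ℂ) (u v : ℝ → ℂ) (z : ℝ) : ℂ :=
  ∫ w in I, (u z - v w) * κ (z, w)

theorem integrable_sub_mul (κ : (ℝ × ℝ) →ᵇ ℂ) (a : ℂ) (v : L2I) (z : ℝ) :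
    Integrable (fun w => (a - v w) * κ (z, w)) (volume.restrict I) := by
  refine Integrable.mul_bdd (c := ‖κ‖) ((integrable_const a).sub (integrable_L2I v)) ?_ ?_
  · exact (κ.continuous.comp (Continuous.prodMk_right z)).aestronglyMeasurable
  · exact Filter.Eventually.of_forall fun w => κ.norm_coe_le_norm _

theorem norm_kernelIntegral_le (κ : (ℝ × ℝ) →ᵇ ℂ) (u v : L2I) (z : ℝ) :
    ‖kernelIntegral κ u v z‖ ≤ ‖κ‖ * (2 * ‖u z‖ + ∫ w in I, ‖v w‖) := by
  have hb : Integrable (fun w => ‖κ‖ * (‖u z‖ + ‖v w‖)) (volume.restrict I) :=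
    ((integrable_const ‖u z‖).add (integrable_L2I v).norm).const_mul ‖κ‖
  refine (norm_integral_le_of_norm_le hb ?_).trans (le_of_eq ?_)
  · refine Filter.Eventually.of_forall fun w => ?_
    rw [norm_mul, mul_comm]
    exact mul_le_mul (κ.norm_coe_le_norm _) (norm_sub_le _ _) (norm_nonneg _) (norm_nonneg _)
  · rw [integral_const_mul, integral_add (integrable_const _) (integrable_L2I v).norm,
      integral_const]
    norm_num

theorem memLp_kernelIntegral (κ : (ℝ × ℝ) →ᵇ ℂ) (u v : L2I) :
    MemLp (kernelIntegral κ u v) 2 (volume.restrict I) := by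
  have hg : MemLp (fun z => ‖κ‖ * (2 * ‖u z‖ + ∫ w in I, ‖v w‖)) 2 (volume.restrict I) :=
    ((((Lp.memLp u).norm.const_mul 2).add (memLp_const (∫ w in I, ‖v w‖))).const_mul ‖κ‖)
  refine hg.mono' ?_ (Filter.Eventually.of_forall (norm_kernelIntegral_le κ u v))
  refine AEStronglyMeasurable.integral_prod_right'
    (f := fun p : ℝ × ℝ => (u p.1 - v p.2) * κ (p.1, p.2)) ?_
  exact (((Lp.aestronglyMeasurable u).comp_fst).sub ((Lp.aestronglyMeasurable v).comp_snd)).mul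
    κ.continuous.aestronglyMeasurable

theorem exists_norm_kernelIntegral_le : ∃ C : ℝ, ∀ (κ : (ℝ × ℝ) →ᵇ ℂ) (u : L2I × L2I),
    ‖(memLp_kernelIntegral κ u.1 u.2).toLp‖ ≤ C * ‖κ‖ * ‖u‖ := by
  have h1 : MemLp (fun _ : ℝ => (1 : ℝ)) 2 (volume.restrict I) := memLp_const 1
  -- The `2` is the length of `I`. One factor `‖1‖` comes from Cauchy–Schwarz for `∫ ‖v‖`, the other
  -- is the `L²` norm of the resulting constant function.
  refine ⟨2 + ‖h1.toLp‖ * ‖h1.toLp‖, fun κ u => ?_⟩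
  have hu : MemLp (fun z => ‖u.1 z‖) 2 (volume.restrict I) := (Lp.memLp u.1).norm
  have hv : MemLp (fun z => ‖u.2 z‖) 2 (volume.restrict I) := (Lp.memLp u.2).norm
  have hun : ‖hu.toLp‖ = ‖u.1‖ := by
    rw [Lp.norm_toLp, eLpNorm_norm, Lp.norm_def]
  have hvn : ‖hv.toLp‖ = ‖u.2‖ := by
    rw [Lp.norm_toLp, eLpNorm_norm, Lp.norm_def]
  have hint : |∫ w in I, ‖u.2 w‖| ≤ ‖h1.toLp‖ * ‖u.2‖ := by
    rw [← hvn]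
    have h2 := abs_real_inner_le_norm h1.toLp hv.toLp
    rw [L2.inner_def] at h2
    refine le_trans (le_of_eq ?_) h2
    congr 1
    refine integral_congr_ae ?_
    filter_upwards [h1.coeFn_toLp, hv.coeFn_toLp] with w hw1 hw2
    rw [hw1, hw2]
    simp
  calc ‖(memLp_kernelIntegral κ u.1 u.2).toLp‖
      ≤ ‖‖κ‖ • ((2 : ℝ) • hu.toLp + (∫ w in I, ‖u.2 w‖) • h1.toLp)‖ := by
        refine Lp.norm_le_norm_of_ae_le ?_
        filter_upwards [(memLp_kernelIntegral κ u.1 u.2).coeFn_toLp, hu.coeFn_toLp, h1.coeFn_toLp,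
          Lp.coeFn_smul ‖κ‖ ((2 : ℝ) • hu.toLp + (∫ w in I, ‖u.2 w‖) • h1.toLp),
          Lp.coeFn_add ((2 : ℝ) • hu.toLp) ((∫ w in I, ‖u.2 w‖) • h1.toLp),
          Lp.coeFn_smul (2 : ℝ) hu.toLp, Lp.coeFn_smul (∫ w in I, ‖u.2 w‖) h1.toLp]
          with z e1 e2 e3 e4 e5 e6 e7
        rw [e1, e4, Pi.smul_apply, e5, Pi.add_apply, e6, e7, Pi.smul_apply, Pi.smul_apply, e2, e3]
        refine (norm_kernelIntegral_le κ u.1 u.2 z).trans ((le_of_eq ?_).trans (le_abs_self _))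
        simp
    _ ≤ ‖κ‖ * (2 * ‖u‖ + ‖h1.toLp‖ * ‖u‖ * ‖h1.toLp‖) := by
        rw [norm_smul, norm_norm]
        refine mul_le_mul_of_nonneg_left ((norm_add_le _ _).trans (add_le_add ?_ ?_))
          (norm_nonneg _)
        · rw [norm_smul, hun]
          norm_num
          exact norm_fst_le u
        · rw [norm_smul, Real.norm_eq_abs]
          gcongr
          refine hint.trans ?_
          gcongr
          exact norm_snd_le u
    _ = _ := by ring

/-- The bounded bilinear map taking a kernel `κ` and a pair `(u, v)` to the function
`z ↦ ∫_I (u(z) - v(w)) κ(z, w) dw`. -/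
noncomputable def kernelOp : ((ℝ × ℝ) →ᵇ ℂ) →L[ℂ] (L2I × L2I) →L[ℂ] L2I :=
  LinearMap.mkContinuousOfExistsBound₂
    (LinearMap.mk₂ ℂ (fun κ u => (memLp_kernelIntegral κ u.1 u.2).toLp)
      (fun κ κ' u => by
        rw [← MemLp.toLp_add, MemLp.toLp_eq_toLp_iff]
        refine Filter.Eventually.of_forall fun z => ?_
        simp only [kernelIntegral, Pi.add_apply]
        rw [← integral_add (integrable_sub_mul _ _ _ _) (integrable_sub_mul _ _ _ _)]
        simp only [BoundedContinuousFunction.coe_add, Pi.add_apply, mul_add])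
      (fun a κ u => by
        rw [← MemLp.toLp_const_smul, MemLp.toLp_eq_toLp_iff]
        refine Filter.Eventually.of_forall fun z => ?_
        simp only [kernelIntegral, Pi.smul_apply]
        rw [smul_eq_mul, ← integral_const_mul]
        simp only [BoundedContinuousFunction.coe_smul, smul_eq_mul, mul_left_comm])
      (fun κ u v => by
        rw [← MemLp.toLp_add, MemLp.toLp_eq_toLp_iff]
        filter_upwards [Lp.coeFn_add u.1 v.1] with z hz
        simp only [kernelIntegral, Pi.add_apply]
        rw [← integral_add (integrable_sub_mul _ _ _ _) (integrable_sub_mul _ _ _ _)]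
        refine integral_congr_ae ?_
        filter_upwards [Lp.coeFn_add u.2 v.2] with w hw
        rw [Prod.fst_add, Prod.snd_add, hz, hw, Pi.add_apply, Pi.add_apply]
        ring)
      (fun a κ u => by
        rw [← MemLp.toLp_const_smul, MemLp.toLp_eq_toLp_iff]
        filter_upwards [Lp.coeFn_smul a u.1] with z hz
        simp only [kernelIntegral, Pi.smul_apply]
        rw [smul_eq_mul, ← integral_const_mul]
        refine integral_congr_ae ?_
        filter_upwards [Lp.coeFn_smul a u.2] with w hw
        rw [Prod.smul_fst, Prod.smul_snd, hz, hw, Pi.smul_apply, Pi.smul_apply, smul_eq_mul,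
          smul_eq_mul]
        ring))
    exists_norm_kernelIntegral_le

variable {k : ℕ}

/-- The perturbation, expressed through `kernelOp`, as a function defined for all `ε`. -/
noncomputable def perturbExt (s : ℝ) (x V : Fin k → ℝ) (ε : ℂ) (u : ProdL2 k) : ProdL2 k :=
  WithLp.toLp 2 fun i => (V i : ℂ) • u i + (fracConst s : ℂ) • ∑ j ∈ Finset.univ.erase i,
    kernelOp (kernelBCF s (x i - x j) ε) (u i, u j)

/-- `perturb` carries a proof that `ε` is admissible, so it is not a function on `ℂ`; `perturbExt`
is one, and makes both continuity in `u` and analyticity in `ε` visible. -/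
theorem perturb_eq_perturbExt (s : ℝ) (x V : Fin k → ℝ) {ε : ℂ}
    (hε : ∀ i j, i ≠ j → 2 * ‖ε‖ < |x i - x j|) (u : ProdL2 k) :
    perturb s x V ε hε u = perturbExt s x V ε u := by
  ext1 i
  change (memLp_perturbFun s x V hε u i).toLp = (V i : ℂ) • u i + (fracConst s : ℂ) •
    ∑ j ∈ Finset.univ.erase i, kernelOp (kernelBCF s (x i - x j) ε) (u i, u j)
  refine Lp.ext ?_
  have hall : ∀ᵐ z ∂(volume.restrict I), ∀ j,
      kernelOp (kernelBCF s (x i - x j) ε) (u i, u j) z =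
        kernelIntegral (kernelBCF s (x i - x j) ε) (u i) (u j) z :=
    ae_all_iff.2 fun j => (memLp_kernelIntegral _ (u i) (u j)).coeFn_toLp
  filter_upwards [(memLp_perturbFun s x V hε u i).coeFn_toLp, hall, ae_mem_I,
    Lp.coeFn_add ((V i : ℂ) • u i) ((fracConst s : ℂ) •
      ∑ j ∈ Finset.univ.erase i, kernelOp (kernelBCF s (x i - x j) ε) (u i, u j)),
    Lp.coeFn_smul (V i : ℂ) (u i), Lp.coeFn_smul (fracConst s : ℂ)
      (∑ j ∈ Finset.univ.erase i, kernelOp (kernelBCF s (x i - x j) ε) (u i, u j)),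
    Lp.coeFn_finsetSum (Finset.univ.erase i)
      (fun j => kernelOp (kernelBCF s (x i - x j) ε) (u i, u j))] with z e1 e2 hz e3 e4 e5 e6
  rw [e1, e3, Pi.add_apply, e4, e5, Pi.smul_apply, Pi.smul_apply, e6, perturbFun, smul_eq_mul,
    smul_eq_mul, Finset.sum_apply]
  congr 2
  refine Finset.sum_congr rfl fun j hj => ?_
  rw [e2 j, kernelIntegral]
  refine integral_congr_ae ?_
  filter_upwards [ae_mem_I] with w hw
  rw [kernelBCF_apply (hε i j (Finset.ne_of_mem_erase hj).symm) hz hw]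

theorem continuous_perturb (s : ℝ) (x V : Fin k → ℝ) {ε : ℂ}
    (hε : ∀ i j, i ≠ j → 2 * ‖ε‖ < |x i - x j|) : Continuous (perturb s x V ε hε) := by
  have : (perturb s x V ε hε : ProdL2 k → ProdL2 k) = perturbExt s x V ε :=
    funext (perturb_eq_perturbExt s x V hε)
  rw [this]
  unfold perturbExt
  fun_prop

theorem analyticAt_perturbExt (s : ℝ) (x V : Fin k → ℝ) {ε : ℂ}
    (hε : ∀ i j, i ≠ j → 2 * ‖ε‖ < |x i - x j|) (u : ProdL2 k) :
    AnalyticAt ℂ (fun ε => perturbExt s x V ε u) ε := by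
  have hpi : AnalyticAt ℂ (fun ε => fun i => (V i : ℂ) • u i + (fracConst s : ℂ) •
      ∑ j ∈ Finset.univ.erase i, kernelOp (kernelBCF s (x i - x j) ε) (u i, u j)) ε := by
    refine AnalyticAt.pi fun i => analyticAt_const.add (AnalyticAt.fun_const_smul ?_)
    refine Finset.analyticAt_fun_sum _ fun j hj => ?_
    have h1 := analyticOnNhd_kernelBCF s (x i - x j) ε
      (hε i j (Finset.ne_of_mem_erase hj).symm)
    exact ((kernelOp.flip (u i, u j)).analyticAt _).comp h1
  exact (((PiLp.continuousLinearEquiv 2 ℂ (fun _ : Fin k => L2I)).symm :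
    (Fin k → L2I) →L[ℂ] ProdL2 k).analyticAt _).comp hpi

end FracLap

/-! ### The parameter region, the product operator, the weak form and the real formula. -/

namespace FracLap

variable {k : ℕ}

theorem isOpen_region (x : Fin k → ℝ) (q : ℕ) : IsOpen (region x q) := by
  have : region x q = ⋂ i, ⋂ j, {β : ℂ | i ≠ j → 2 * ‖β‖ ^ q < |x i - x j|} := by
    ext β; simp [region]
  rw [this]
  refine isOpen_iInter_of_finite fun i => isOpen_iInter_of_finite fun j => ?_
  by_cases hij : i = j
  · simp [hij]
  · simp only [ne_eq, hij, not_false_eq_true, forall_const]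
    exact isOpen_lt (by fun_prop) continuous_const

theorem zero_mem_region {x : Fin k → ℝ} (hx : Function.Injective x) {q : ℕ} (hq : q ≠ 0) :
    (0 : ℂ) ∈ region x q := fun i j hij => by
  rw [norm_zero, zero_pow hq, mul_zero]
  exact abs_pos.2 (sub_ne_zero.2 (hx.ne hij))

theorem isConnected_region {x : Fin k → ℝ} (hx : Function.Injective x) {q : ℕ} (hq : q ≠ 0) :
    IsConnected (region x q) := by
  -- The region is star-shaped about `0`, since shrinking `β` radially preserves the strict upper
  -- bounds on `‖β‖^q`.
  refine (StarConvex.isPathConnected ?_ (zero_mem_region hx hq)).isConnected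
  rw [starConvex_zero_iff]
  intro β hβ a ha0 ha1 i j hij
  refine lt_of_le_of_lt ?_ (hβ i j hij)
  have : ‖a • β‖ ≤ ‖β‖ := by
    rw [norm_smul, Real.norm_eq_abs, abs_of_nonneg ha0]
    exact mul_le_of_le_one_left (norm_nonneg _) ha1
  gcongr

theorem prodFracLap_accretive {s : ℝ} (h0 : 0 < s) (h1 : s < 1) (u : (prodFracLap k s).domain) :
    0 ≤ (inner ℂ (u : ProdL2 k) (prodFracLap k s u)).re := by
  rw [PiLp.inner_apply, Complex.re_sum]
  exact Finset.sum_nonneg fun i _ => resFracLap_accretive h0 h1 ⟨u.1 i, u.2 i⟩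

theorem prodFracLap_add_surjective {s : ℝ} (h0 : 0 < s) (h1 : s < 1) {M : ℝ} (hM : 0 < M)
    (f : ProdL2 k) :
    ∃ u : (prodFracLap k s).domain, prodFracLap k s u + (M : ℂ) • (u : ProdL2 k) = f := by
  choose u hu using fun i => resFracLap_add_surjective h0 h1 hM (f i)
  refine ⟨⟨WithLp.toLp 2 fun i => (u i : L2I), fun i => (u i).2⟩, ?_⟩
  ext1 i
  exact hu i

theorem energy_zero_right (s : ℝ) (u : L2I) : energy s u 0 = 0 := by
  rw [energy_eq, integral_eq_zero_of_ae, mul_zero]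
  filter_upwards [gagliardoQuot_zero s] with p hp
  simp [hp]

theorem mem_prodFracLap_graph {s : ℝ} (h0 : 0 < s) (h1 : s < 1) {u f : ProdL2 k} :
    (u, f) ∈ (prodFracLap k s).graph ↔
      u ∈ ProdHs0 k s ∧ ∀ v ∈ ProdHs0 k s, ∑ i, energy s (u i) (v i) = inner ℂ v f := by
  have hiff : (u, f) ∈ (prodFracLap k s).graph ↔ ∀ i, (u i, f i) ∈ (resFracLap s).graph := by
    rw [LinearPMap.mem_graph_iff]
    constructor
    · rintro ⟨y, rfl, rfl⟩ i
      exact (resFracLap s).mem_graph ⟨y.1 i, y.2 i⟩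
    · intro h
      have hd : ∀ i, u i ∈ (resFracLap s).domain := fun i => LinearPMap.mem_domain_of_mem_graph (h i)
      refine ⟨⟨u, hd⟩, rfl, ?_⟩
      ext1 i
      exact LinearPMap.mem_graph_snd_inj _ ((resFracLap s).mem_graph ⟨u i, hd i⟩) (h i) rfl
  rw [hiff]
  constructor
  · intro h
    refine ⟨fun i => ((mem_resFracLap_graph h0 h1).1 (h i)).1, fun v hv => ?_⟩
    rw [PiLp.inner_apply]
    exact Finset.sum_congr rfl fun i _ => ((mem_resFracLap_graph h0 h1).1 (h i)).2 _ (hv i)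
  · rintro ⟨hu, h⟩ i
    refine (mem_resFracLap_graph h0 h1).2 ⟨hu i, fun v hv => ?_⟩
    -- Testing with vectors that have a single nonzero component decouples the summed identity.
    have hmem : WithLp.toLp 2 (Pi.single i v) ∈ ProdHs0 k s := fun j => by
      change (Pi.single i v : Fin k → L2I) j ∈ Hs0 s
      rcases eq_or_ne j i with rfl | hj
      · rwa [Pi.single_eq_same]
      · rw [Pi.single_eq_of_ne hj]; exact zero_mem _
    have h2 := h _ hmem
    rw [PiLp.inner_apply, Finset.sum_eq_single i, Finset.sum_eq_single i] at h2
    · simpa using h2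
    · intro j _ hj
      simp [hj]
    · simp
    · intro j _ hj
      simp [hj, energy_zero_right]
    · simp

/-- `rescaledOp` is the operator associated in the weak sense with `rescaledForm`. -/
theorem mem_rescaledOp_graph {x V : Fin k → ℝ} {p q : ℕ} (h0 : 0 < (p : ℝ) / q)
    (h1 : (p : ℝ) / q < 1) (β : region x q) (u f : ProdL2 k) :
    (u, f) ∈ (rescaledOp x V p q β).graph ↔
      u ∈ ProdHs0 k ((p : ℝ) / q) ∧
        ∀ v ∈ ProdHs0 k ((p : ℝ) / q), rescaledForm x V p q β u v = inner ℂ v f := by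
  set B := (β : ℂ) ^ (q + 2 * p) •
    perturb ((p : ℝ) / q) x V ((β : ℂ) ^ q) (norm_pow_of_mem_region β) with hB
  -- The perturbation is defined on the whole space, so it can be moved to the right-hand side.
  have hgraph : (u, f) ∈ (rescaledOp x V p q β).graph ↔
      (u, f - B u) ∈ (prodFracLap k ((p : ℝ) / q)).graph := by
    rw [LinearPMap.mem_graph_iff, LinearPMap.mem_graph_iff]
    refine exists_congr fun y => and_congr_right fun hy => ?_
    have hy' : (y : ProdL2 k) = u := hy
    change B y + prodFracLap k ((p : ℝ) / q) y = f ↔ prodFracLap k ((p : ℝ) / q) y = f - B u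
    rw [hy', eq_sub_iff_add_eq']
  rw [hgraph, mem_prodFracLap_graph h0 h1]
  refine and_congr_right fun _ => forall₂_congr fun v _ => ?_
  rw [inner_sub_right, eq_sub_iff_add_eq, hB, LinearMap.smul_apply, inner_smul_right]
  rfl

theorem norm_pow_lt_of_mem_region {x : Fin k → ℝ} {q : ℕ} {β : ℂ} (hβ : β ∈ region x q) :
    ∀ i j, i ≠ j → 2 * ‖β ^ q‖ < |x i - x j| := norm_pow_of_mem_region ⟨β, hβ⟩

theorem analyticAt_smul_perturbExt (s : ℝ) (x V : Fin k → ℝ) (n : ℕ) {q : ℕ} {β : ℂ}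
    (hβ : β ∈ region x q) (u : ProdL2 k) :
    AnalyticAt ℂ (fun β => β ^ n • perturbExt s x V (β ^ q) u) β :=
  (analyticAt_id.pow n).smul (AnalyticAt.fun_comp (g := fun ε => perturbExt s x V ε u)
    (analyticAt_perturbExt s x V (norm_pow_lt_of_mem_region hβ) u) (analyticAt_id.pow q))

theorem isAnalyticFamilyTypeA_rescaledOp {x : Fin k → ℝ} (V : Fin k → ℝ)
    (hx : Function.Injective x) {p q : ℕ} (h0 : 0 < (p : ℝ) / q) (h1 : (p : ℝ) / q < 1)
    (hq : q ≠ 0) :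
    IsAnalyticFamilyTypeA (region x q) (prodDomain k ((p : ℝ) / q)) (rescaledOp x V p q) := by
  have hres : ∀ β, ∃ μ : ℂ, MemResolventSet (rescaledOp x V p q β) μ := fun β =>
    exists_memResolventSet_vadd (fun M hM f => prodFracLap_add_surjective h0 h1 hM f)
      (prodFracLap_accretive h0 h1)
      ⟨(β : ℂ) ^ (q + 2 * p) •
        perturb ((p : ℝ) / q) x V ((β : ℂ) ^ q) (norm_pow_of_mem_region β),
        (continuous_perturb _ x V (norm_pow_of_mem_region β)).const_smul _⟩
  exact
    { isOpen := isOpen_region x q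
      isConnected := isConnected_region hx hq
      dense := dense_domain_of_accretive (prodFracLap_accretive h0 h1)
        (prodFracLap_add_surjective h0 h1 one_pos)
      domain_eq := fun _ => rfl
      isClosed := fun β => (hres β).choose_spec.isClosed
      resolventSet_nonempty := hres
      analytic := fun u hu =>
        ⟨fun β => β ^ (q + 2 * p) • perturbExt ((p : ℝ) / q) x V (β ^ q) u +
          prodFracLap k ((p : ℝ) / q) ⟨u, hu⟩,
          fun β hβ => (analyticAt_smul_perturbExt _ x V _ hβ u).add analyticAt_const,
          fun β _ => by
            exact congrArg (fun y => (β : ℂ) ^ (q + 2 * p) • y + prodFracLap k ((p : ℝ) / q) ⟨u, hu⟩)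
              (perturb_eq_perturbExt _ x V (norm_pow_of_mem_region β) u).symm⟩ }

theorem exists_analyticOnNhd_rescaledForm (x V : Fin k → ℝ) (p q : ℕ) (u v : ProdL2 k) :
    ∃ g : ℂ → ℂ, AnalyticOnNhd ℂ g (region x q) ∧
      ∀ β : region x q, g β = rescaledForm x V p q β u v := by
  refine ⟨fun β => ∑ i, energy ((p : ℝ) / q) (u i) (v i) +
    innerSL ℂ v (β ^ (q + 2 * p) • perturbExt ((p : ℝ) / q) x V (β ^ q) u), fun β hβ => ?_,
    fun β => ?_⟩
  · exact analyticAt_const.add (((innerSL ℂ v).analyticAt _).fun_comp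
      (analyticAt_smul_perturbExt _ x V _ hβ u))
  · rw [rescaledForm, perturb_eq_perturbExt, ← inner_smul_right]
    rfl

/-- The base `1 + ε (z - w)/d` is a positive real, so its principal power is the real one and `|d|`
can be absorbed into it. -/
theorem kernel_ofReal {s d ε z w : ℝ} (hε : 0 < ε) (h : 2 * ε < |d|) (hz : z ∈ I) (hw : w ∈ I) :
    kernel s d ε z w = (((|ε * (z - w) + d| ^ (1 + 2 * s) : ℝ) : ℂ))⁻¹ := by
  have hd : 0 < |d| := lt_trans (by positivity) h
  have hd0 : d ≠ 0 := abs_pos.1 hd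
  have hzw : |z - w| ≤ 2 := by
    rw [abs_le]; constructor <;> linarith [hz.1, hz.2, hw.1, hw.2]
  have hpos : 0 < 1 + ε * (z - w) / d := by
    have h2 : |ε * (z - w) / d| < 1 := by
      rw [abs_div, abs_mul, abs_of_pos hε, div_lt_one hd]
      nlinarith
    linarith [(abs_lt.1 h2).1]
  have heq : |ε * (z - w) + d| = |d| * (1 + ε * (z - w) / d) := by
    have hmul : d * (1 + ε * (z - w) / d) = ε * (z - w) + d := by
      field_simp
      ring
    rw [← hmul, abs_mul, abs_of_pos hpos]
  have hc : (1 + (ε : ℂ) * ((z - w : ℝ) : ℂ) / (d : ℂ)) = ((1 + ε * (z - w) / d : ℝ) : ℂ) := by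
    push_cast; ring
  rw [kernel, hc, ← Complex.ofReal_cpow hpos.le, ← Complex.ofReal_mul, ← Complex.ofReal_inv,
    ← Real.mul_rpow hd.le hpos.le, ← heq, Real.rpow_neg (abs_nonneg _)]

theorem rpow_one_div_mem_region {x : Fin k → ℝ} {q : ℕ} (hq : q ≠ 0) {ε : ℝ} (hε : 0 < ε)
    (h : ∀ i j, i ≠ j → 2 * ε < |x i - x j|) :
    ((ε ^ (1 / (q : ℝ)) : ℝ) : ℂ) ∈ region x q := fun i j hij => by
  rw [Complex.norm_real, Real.norm_eq_abs, abs_of_nonneg (by positivity), one_div,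
    Real.rpow_inv_natCast_pow hε.le hq]
  exact h i j hij

theorem rescaledOp_apply_of_pow_eq {x V : Fin k → ℝ} {p q : ℕ} (hq : q ≠ 0) {ε : ℝ} (hε : 0 < ε)
    (β : region x q) (hβ : (β : ℂ) = ((ε ^ (1 / (q : ℝ)) : ℝ) : ℂ))
    (u : (rescaledOp x V p q β).domain) (i : Fin k)
    (hui : (u : ProdL2 k) i ∈ (resFracLap ((p : ℝ) / q)).domain) :
    ∀ᵐ z ∂(volume.restrict I), (rescaledOp x V p q β u) i z =
      resFracLap ((p : ℝ) / q) ⟨(u : ProdL2 k) i, hui⟩ z +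
        ((ε ^ (1 + 2 * ((p : ℝ) / q)) : ℝ) : ℂ) * ((V i : ℂ) * (u : ProdL2 k) i z +
          (fracConst ((p : ℝ) / q) : ℂ) * ∑ j ∈ Finset.univ.erase i, ∫ w in I,
            ((u : ProdL2 k) i z - (u : ProdL2 k) j w) /
              ((|ε * (z - w) + x i - x j| ^ (1 + 2 * ((p : ℝ) / q)) : ℝ) : ℂ)) := by
  have hq' : (q : ℝ) ≠ 0 := by exact_mod_cast hq
  have hpow : (β : ℂ) ^ q = (ε : ℂ) := by
    rw [hβ, ← Complex.ofReal_pow, one_div, Real.rpow_inv_natCast_pow hε.le hq]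
  -- The exponents match because `(q + 2p)/q = 1 + 2s`.
  have hpow' : (β : ℂ) ^ (q + 2 * p) = ((ε ^ (1 + 2 * ((p : ℝ) / q)) : ℝ) : ℂ) := by
    rw [hβ, ← Complex.ofReal_pow, ← Real.rpow_mul_natCast hε.le]
    congr 2
    push_cast
    field_simp
  have h : ∀ i j, i ≠ j → 2 * ε < |x i - x j| := fun i j hij => by
    have := norm_pow_of_mem_region β i j hij
    rwa [hpow, Complex.norm_real, Real.norm_eq_abs, abs_of_pos hε] at this
  have hmem := memLp_perturbFun ((p : ℝ) / q) x V (norm_pow_of_mem_region β) (u : ProdL2 k) i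
  have happ : (rescaledOp x V p q β u) i =
      (β : ℂ) ^ (q + 2 * p) • hmem.toLp + resFracLap ((p : ℝ) / q) ⟨(u : ProdL2 k) i, hui⟩ := rfl
  rw [happ]
  filter_upwards [Lp.coeFn_add ((β : ℂ) ^ (q + 2 * p) • hmem.toLp)
      (resFracLap ((p : ℝ) / q) ⟨(u : ProdL2 k) i, hui⟩),
    Lp.coeFn_smul ((β : ℂ) ^ (q + 2 * p)) hmem.toLp, hmem.coeFn_toLp, ae_mem_I]
    with z e1 e2 e3 hz
  rw [e1, Pi.add_apply, e2, Pi.smul_apply, e3, smul_eq_mul, add_comm, hpow', perturbFun, hpow]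
  congr 4
  refine Finset.sum_congr rfl fun j hj => integral_congr_ae ?_
  filter_upwards [ae_mem_I] with w hw
  rw [kernel_ofReal hε (h i j (Finset.ne_of_mem_erase hj).symm) hz hw, add_sub_assoc]
  exact (div_eq_mul_inv _ _).symm

end FracLap

theorem mainTheorem8 (k : ℕ) (x V : Fin k → ℝ) (hx : Function.Injective x) (p q : ℕ)
    (hp : 0 < p) (hpq : p < q) :
    -- type (A), with the common domain
    IsAnalyticFamilyTypeA (FracLap.region x q) (FracLap.prodDomain k ((p : ℝ) / q))
      (FracLap.rescaledOp x V p q) ∧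
    -- the region is a neighbourhood of zero
    (0 : ℂ) ∈ FracLap.region x q ∧
    -- the operator is the realisation in the product of the `L²(I)` of its weak form, which is
    -- defined on the product of the `H^s_0(I)`
    (∀ (β : FracLap.region x q) (u f : FracLap.ProdL2 k),
      (u, f) ∈ (FracLap.rescaledOp x V p q β).graph ↔
        u ∈ FracLap.ProdHs0 k ((p : ℝ) / q) ∧
          ∀ v ∈ FracLap.ProdHs0 k ((p : ℝ) / q),
            FracLap.rescaledForm x V p q β u v = inner ℂ v f) ∧
    -- the weak form is analytic in the parameter on the whole product of the `H^s_0(I)`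
    (∀ u ∈ FracLap.ProdHs0 k ((p : ℝ) / q), ∀ v ∈ FracLap.ProdHs0 k ((p : ℝ) / q),
      ∃ g : ℂ → ℂ, AnalyticOnNhd ℂ g (FracLap.region x q) ∧
        ∀ β : FracLap.region x q, g β = FracLap.rescaledForm x V p q β u v) ∧
    -- at `β = ε^{1/q}` with `ε > 0` the operator is given by the original formula
    (∀ (ε : ℝ), 0 < ε → (∀ i j, i ≠ j → 2 * ε < |x i - x j|) →
      ∃ hβ : ((ε ^ (1 / (q : ℝ)) : ℝ) : ℂ) ∈ FracLap.region x q,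
        ∀ (u : (FracLap.rescaledOp x V p q ⟨_, hβ⟩).domain) (i : Fin k),
          ∃ hui : (u : FracLap.ProdL2 k) i ∈ (FracLap.resFracLap ((p : ℝ) / q)).domain,
            ∀ᵐ z ∂(volume.restrict FracLap.I),
              (FracLap.rescaledOp x V p q ⟨_, hβ⟩ u) i z =
                FracLap.resFracLap ((p : ℝ) / q) ⟨_, hui⟩ z +
                  ((ε ^ (1 + 2 * ((p : ℝ) / q)) : ℝ) : ℂ) *
                    ((V i : ℂ) * (u : FracLap.ProdL2 k) i z +
                      (FracLap.fracConst ((p : ℝ) / q) : ℂ) *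
                        ∑ j ∈ Finset.univ.erase i, ∫ w in FracLap.I,
                          ((u : FracLap.ProdL2 k) i z - (u : FracLap.ProdL2 k) j w) /
                            ((|ε * (z - w) + x i - x j| ^ (1 + 2 * ((p : ℝ) / q)) : ℝ) : ℂ))) := by
  have hq : q ≠ 0 := (hp.trans hpq).ne'
  have hq' : (0 : ℝ) < q := by exact_mod_cast hp.trans hpq
  have h0 : 0 < (p : ℝ) / q := div_pos (by exact_mod_cast hp) hq'
  have h1 : (p : ℝ) / q < 1 := (div_lt_one hq').2 (by exact_mod_cast hpq)
  exact ⟨FracLap.isAnalyticFamilyTypeA_rescaledOp V hx h0 h1 hq, FracLap.zero_mem_region hx hq,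
    FracLap.mem_rescaledOp_graph h0 h1,
    fun u _ v _ => FracLap.exists_analyticOnNhd_rescaledForm x V p q u v,
    fun ε hε h => ⟨FracLap.rpow_one_div_mem_region hq hε h, fun u i =>
      ⟨u.2 i, FracLap.rescaledOp_apply_of_pow_eq hq hε ⟨_, _⟩ rfl u i (u.2 i)⟩⟩⟩
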